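/- For $j\in\frac12\mathbb N$ let $V^j$ be the spin-$j$ unitary representation of $SU(2)$, of dimension $2j+1$, with orthonormal basis $|j,m\rangle$, $-j\le m\le j$; let $\bar V^j$ be its dual, with basis $\langle j,m|$. Put $D^j_{mn}(h)=\langle j,m|h|j,n\rangle$. Let $P,Q\in\mathbb N$ and consider the graph with two vertices $v_1,v_2$ joined by one internal edge $e$, with $P$ boundary edges at $v_1$ and $Q$ boundary edges at $v_2$. Boundary edges may carry arbitrary superpositions of spins: $V^I=\bigoplus_j V^j$ for $1\le I\le P$ and $\bar V^J=\bigoplus_j\bar V^j$ for $1\le J\le Q$ (Hilbert direct sums; fixed boundary spins are the special case of states supported on one value of each boundary spin). All tensor products are Hilbert tensor products. For each $j$ let $$\mathcal H^j_{v_1}=\mathrm{Inv}_{SU(2)}\Big(\bigotimes_{I=1}^P V^I\otimes\bar V^j\Big),\qquad \mathcal H^j_{v_2}=\mathrm{Inv}_{SU(2)}\Big(V^j\otimes\bigotimes_{J=1}^Q\bar V^J\Big),$$ and let $|\Psi^j_\Gamma\rangle\in\mathcal H^j_{v_1}\otimes\mathcal H^j_{v_2}$ and $\alpha_j\in\mathbb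 C$ be such that $\sum_j\tilde p_j=1$, where $\tilde p_j:=|\alpha_j|^2$, and $\||\Psi^j_\Gamma\rangle\|=1$ whenever $\alpha_j\ne0$. Let $|\Psi_\Gamma\rangle=\sum_j\alpha_j|\Psi^j_\Gamma\rangle$. For $h\in SU(2)$ let the boundary state with holonomy $h$ along $e$ be $$|\Psi_\Gamma(h)\rangle_\partial=\sum_j\alpha_j\sqrt{2j+1}\sum_{m,n}D^j_{mn}(h)\,\Psi^j_{mn}\in\mathcal H^\partial_{v_1}\otimes\mathcal H^\partial_{v_2},\qquad \mathcal H^\partial_{v_1}=\bigotimes_{I}V^I,\quad \mathcal H^\partial_{v_2}=\bigotimes_J\bar V^J,$$ where $\Psi^j_{mn}\in\mathcal H^\partial_{v_1}\otimes\mathcal H^\partial_{v_2}$ is the component of $|\Psi^j_\Gamma\rangle$ along $\langle j,m|\otimes|j,n\rangle$ on the two internal half-edges. Put $$\tilde\rho^{\partial}_{v_1}(h)=\mathrm{Tr}_{\mathcal H^\partial_{v_2}}|\Psi_\Gamma(h)\rangle\langle\Psi_\Gamma(h)|_\partial,\qquad \rho^j_{v_1}=\mathrm{Tr}_{\mathcal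 H_{v_2}}|\Psi^j_\Gamma\rangle\langle\Psi^j_\Gamma|,\qquad \tilde\rho_{v_1}=\mathrm{Tr}_{\mathcal H_{v_2}}|\Psi_\Gamma\rangle\langle\Psi_\Gamma| .$$ Then for every $h\in SU(2)$ the series defining $|\Psi_\Gamma\rangle$ and $|\Psi_\Gamma(h)\rangle_\partial$ converge, and: 1. $\tilde\rho^\partial_{v_1}(h)=\tilde\rho^\partial_{v_1}(\mathbf 1)$: the boundary reduced density matrix does not depend on the holonomy; 2. $\tilde\rho_{v_1}=\bigoplus_j\tilde p_j\,\rho^j_{v_1}$ and $\tilde\rho^\partial_{v_1}(h)=\mathrm{Tr}_{V_e}\tilde\rho_{v_1}$, where $\mathrm{Tr}_{V_e}$ is the partial trace over the internal leg at $v_1$, $V_e=\bigoplus_jV^j$ (up to duality); 3. with $E(v_1^\partial|v_2^\partial)=-\mathrm{Tr}(\tilde\rho^\partial_{v_1}(h)\ln\tilde\rho^\partial_{v_1}(h))$ and $E_j(v_1|v_2)=-\mathrm{Tr}(\rho^j_{v_1}\ln\rho^j_{v_1})$, as an identity in $[0,\infty]$ (with $0\ln0=0$ and $0\cdot\infty=0$),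 $$E(v_1^\partial|v_2^\partial)=\sum_j\tilde p_j\ln(2j+1)-\sum_j\tilde p_j\ln\tilde p_j+\sum_j\tilde p_j\,E_j(v_1|v_2).$$ -/

import Mathlib

open scoped ENNReal

noncomputable section

namespace SpinNetwork

/-! ### Hilbert spaces with a distinguished orthonormal basis -/

/-- The Hilbert space of square-summable families indexed by `X`, with orthonormal basis `X`.
The Hilbert tensor product of `L2 X` and `L2 Y` is `L2 (X × Y)`. -/
abbrev L2 (X : Type) : Type := lp (fun _ : X => ℂ) 2

theorem memlp_comp {X Y : Type} (f : X → Y) (hf : Function.Injective f) (u : L2 Y) :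
    Memℓp (fun x => u (f x)) 2 := by
  have h : Summable fun y => ‖u y‖ ^ (2 : ℝ≥0∞).toReal := (lp.memℓp u).summable (by norm_num)
  exact memℓp_gen (h.comp_injective hf)

/-- The coordinate restriction `u ↦ u ∘ f` along an injection of index sets. -/
def pullback {X Y : Type} (f : X → Y) (hf : Function.Injective f) : L2 Y →L[ℂ] L2 X :=
  LinearMap.mkContinuous
    { toFun := fun u => ⟨fun x => u (f x), memlp_comp f hf u⟩
      map_add' := fun _ _ => rfl
      map_smul' := fun _ _ => rfl } 1 (by
    intro u
    rw [one_mul]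
    have h : Summable fun y => ‖u y‖ ^ (2 : ℝ≥0∞).toReal := (lp.memℓp u).summable (by norm_num)
    refine lp.norm_le_of_tsum_le (by norm_num) (norm_nonneg u) ?_
    rw [lp.norm_rpow_eq_tsum (by norm_num) u]
    exact tsum_comp_le_tsum_of_inj h (fun _ => by positivity) hf)

/-- The partial contraction `u ↦ ⟨y | u⟩` with the basis vector `y` of the second factor. -/
def slice {X Y : Type} (y : Y) : L2 (X × Y) →L[ℂ] L2 X :=
  pullback (fun x => (x, y)) (fun _ _ h => congrArg Prod.fst h)

/-- The partial trace over the second factor, `T ↦ ∑_y ⟨y| T |y⟩`. -/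
def partialTrace {X Y : Type} (T : L2 (X × Y) →L[ℂ] L2 (X × Y)) : L2 X →L[ℂ] L2 X :=
  ∑' y : Y, (slice y).comp (T.comp (ContinuousLinearMap.adjoint (slice (X := X) y)))

/-- The rank-one operator `|u⟩⟨u|`. -/
def ketBra {X : Type} (u : L2 X) : L2 X →L[ℂ] L2 X :=
  InnerProductSpace.rankOne ℂ u u

/-- The reduced density matrix on the first factor of the vector `u`: the partial trace of
`|u⟩⟨u|` over the second factor. -/
def reducedDensity {X Y : Type} (u : L2 (X × Y)) : L2 X →L[ℂ] L2 X :=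
  partialTrace (ketBra u)

/-- The operator `-ρ ln ρ`, defined by the continuous functional calculus applied to
`Real.negMulLog t = -t ln t`. -/
def negMulLogOp {H : Type} [NormedAddCommGroup H] [InnerProductSpace ℂ H] [CompleteSpace H]
    (ρ : H →L[ℂ] H) : H →L[ℂ] H :=
  cfc Real.negMulLog ρ

open scoped Classical in
/-- The von Neumann entropy `-Tr (ρ ln ρ)` of a density matrix, with values in `[0, ∞]`; the trace
is taken in the distinguished basis (its terms are nonnegative). -/
def entropy {X : Type} (ρ : L2 X →L[ℂ] L2 X) : ℝ≥0∞ :=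
  ∑' x : X, ENNReal.ofReal
    (inner ℂ (lp.single 2 x (1 : ℂ) : L2 X) (negMulLogOp ρ (lp.single 2 x (1 : ℂ)))).re

/-! ### Representations of SU(2)

Spins are recorded by the natural number `n = 2 j`. The basis vector `|j, m⟩` of `V^j` is recorded
by `k = j + m`, an element of `Fin (n + 1)`. -/

/-- The spin `j = n / 2`. -/
def spin (n : ℕ) : ℝ := (n : ℝ) / 2

/-- The group `SU(2)`. -/
abbrev SU2 : Type := Matrix.specialUnitaryGroup (Fin 2) ℂ

open Polynomial in
/-- The matrix `⟨j, m| g |j, m'⟩` of the spin-`n/2` representation. The space `V^j` is the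
space of homogeneous polynomials of degree `n` in two variables `x, y` (spin up, spin down), with
orthonormal basis `√(n choose k) x ^ k y ^ (n - k)`, on which `g` acts by
`x ↦ g₀₀ x + g₁₀ y`, `y ↦ g₀₁ x + g₁₁ y`. In the formula `y` is set to `1`. -/
def wignerD (n : ℕ) (g : SU2) : Matrix (Fin (n + 1)) (Fin (n + 1)) ℂ := fun k l =>
  ((Real.sqrt (n.choose l) / Real.sqrt (n.choose k) : ℝ) : ℂ) *
    ((C (g.1 0 0) * X + C (g.1 1 0)) ^ (l : ℕ) *
      (C (g.1 0 1) * X + C (g.1 1 1)) ^ (n - (l : ℕ)) : ℂ[X]).coeff k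

/-- Index set of the orthonormal basis `|j, m⟩` of `⨁_j V^j` (and of the dual basis `⟨j, m|`
of `⨁_j V̄^j`). -/
abbrev Leg : Type := Σ n : ℕ, Fin (n + 1)

/-- Index set of the product basis of the tensor product over `P` legs; each leg carries
`⨁_j V^j` (or its dual). -/
abbrev Legs (P : ℕ) : Type := Fin P → Leg

/-- The action of `g` on coefficients of vectors of `⨂_I V^I ⊗ V̄^e`: each factor `|j, m⟩` goes to
`g |j, m⟩`, and the last factor `⟨j, m|` goes to `⟨j, m| g⁻¹`. -/
def actLeft {P : ℕ} (g : SU2) (u : Legs P × Leg → ℂ) (x : Legs P × Leg) : ℂ :=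
  ∑ k : (I : Fin P) → Fin ((x.1 I).1 + 1), ∑ m : Fin (x.2.1 + 1),
    (∏ I, wignerD (x.1 I).1 g (x.1 I).2 (k I)) * wignerD x.2.1 g⁻¹ m x.2.2 *
      u (fun I => ⟨(x.1 I).1, k I⟩, ⟨x.2.1, m⟩)

/-- The action of `g` on coefficients of vectors of `V^e ⊗ ⨂_J V̄^J`. -/
def actRight {Q : ℕ} (g : SU2) (w : Leg × Legs Q → ℂ) (y : Leg × Legs Q) : ℂ :=
  ∑ m : Fin (y.1.1 + 1), ∑ k : (J : Fin Q) → Fin ((y.2 J).1 + 1),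
    wignerD y.1.1 g y.1.2 m * (∏ J, wignerD (y.2 J).1 g⁻¹ (k J) (y.2 J).2) *
      w (⟨y.1.1, m⟩, fun J => ⟨(y.2 J).1, k J⟩)

/-- `H_{v₁}` at internal spin `n / 2`: the `SU(2)`-invariant vectors of `⨂_I V^I ⊗ V̄^e` whose
internal leg carries the spin `n / 2`. -/
def leftIntertwiners (P n : ℕ) : Submodule ℂ (L2 (Legs P × Leg)) where
  carrier := {u | (∀ g x, actLeft g u x = u x) ∧ ∀ x, x.2.1 ≠ n → u x = 0}
  zero_mem' := by simp [actLeft]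
  add_mem' := by
    rintro u v ⟨hu, hu'⟩ ⟨hv, hv'⟩
    refine ⟨fun g x => ?_, fun x hx => ?_⟩
    · have : actLeft g (u + v : L2 (Legs P × Leg)) x = actLeft g u x + actLeft g v x := by
        simp [actLeft, mul_add, Finset.sum_add_distrib]
      rw [this, hu, hv]; rfl
    · simp [hu' x hx, hv' x hx]
  smul_mem' := by
    rintro c u ⟨hu, hu'⟩
    refine ⟨fun g x => ?_, fun x hx => ?_⟩
    · have : actLeft g (c • u : L2 (Legs P × Leg)) x = c * actLeft g u x := by
        simp only [actLeft, lp.coeFn_smul, Pi.smul_apply, smul_eq_mul, Finset.mul_sum]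
        exact Finset.sum_congr rfl fun _ _ => Finset.sum_congr rfl fun _ _ => by ring
      rw [this, hu]; rfl
    · simp [hu' x hx]

/-- `H_{v₂}` at internal spin `n / 2`: the `SU(2)`-invariant vectors of `V^e ⊗ ⨂_J V̄^J` whose
internal leg carries the spin `n / 2`. -/
def rightIntertwiners (Q n : ℕ) : Submodule ℂ (L2 (Leg × Legs Q)) where
  carrier := {w | (∀ g y, actRight g w y = w y) ∧ ∀ y, y.1.1 ≠ n → w y = 0}
  zero_mem' := by simp [actRight]
  add_mem' := by
    rintro u v ⟨hu, hu'⟩ ⟨hv, hv'⟩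
    refine ⟨fun g x => ?_, fun x hx => ?_⟩
    · have : actRight g (u + v : L2 (Leg × Legs Q)) x = actRight g u x + actRight g v x := by
        simp [actRight, mul_add, Finset.sum_add_distrib]
      rw [this, hu, hv]; rfl
    · simp [hu' x hx, hv' x hx]
  smul_mem' := by
    rintro c u ⟨hu, hu'⟩
    refine ⟨fun g x => ?_, fun x hx => ?_⟩
    · have : actRight g (c • u : L2 (Leg × Legs Q)) x = c * actRight g u x := by
        simp only [actRight, lp.coeFn_smul, Pi.smul_apply, smul_eq_mul, Finset.mul_sum]
        exact Finset.sum_congr rfl fun _ _ => Finset.sum_congr rfl fun _ _ => by ring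
      rw [this, hu]; rfl
    · simp [hu' x hx]

/-- The intertwiner Hilbert space `H_Γ = H_{v₁} ⊗ H_{v₂}` of the two-vertex graph at internal
spin `n / 2`: the closed linear span of the product vectors `u ⊗ w`. -/
def intertwinerSpace (P Q n : ℕ) : Submodule ℂ (L2 ((Legs P × Leg) × (Leg × Legs Q))) :=
  (Submodule.span ℂ {Φ | ∃ u ∈ leftIntertwiners P n, ∃ w ∈ rightIntertwiners Q n,
    ∀ x y, Φ (x, y) = u x * w y}).topologicalClosure

/-! ### Gluing -/

/-- The contraction `Φ ↦ ⟨e, e' | Φ⟩` of the two internal half-legs with basis vectors. -/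
def internalSlice {P Q : ℕ} (e e' : Leg) :
    L2 ((Legs P × Leg) × (Leg × Legs Q)) →L[ℂ] L2 (Legs P × Legs Q) :=
  pullback (fun x => ((x.1, e), (e', x.2))) (fun x x' h => by
    simp only [Prod.mk.injEq, and_true, true_and] at h
    exact Prod.ext h.1 h.2)

/-- The gluing map at internal spin `j = n / 2` with holonomy `h`: it replaces
`⟨j, m| ⊗ |j, m'⟩` on the internal half-legs by `√(2j+1) ⟨j, m| h |j, m'⟩`. -/
def gluingMap {P Q : ℕ} (n : ℕ) (h : SU2) (Φ : L2 ((Legs P × Leg) × (Leg × Legs Q))) :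
    L2 (Legs P × Legs Q) :=
  ((Real.sqrt (2 * spin n + 1) : ℝ) : ℂ) •
    ∑ m : Fin (n + 1), ∑ m' : Fin (n + 1), wignerD n h m m' • internalSlice ⟨n, m⟩ ⟨n, m'⟩ Φ

/-- The intertwiner state `|Ψ_Γ⟩ = ∑_j α_j |Ψ^j_Γ⟩`. -/
def graphState {P Q : ℕ} (α : ℕ → ℂ) (Ψ : ℕ → L2 ((Legs P × Leg) × (Leg × Legs Q))) :
    L2 ((Legs P × Leg) × (Leg × Legs Q)) :=
  ∑' n, α n • Ψ n

/-- The boundary state obtained from `∑_j α_j |Ψ^j_Γ⟩` by gluing with the holonomy `h`. Gluing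
without holonomy is the case `h = 1`. -/
def boundaryState {P Q : ℕ} (α : ℕ → ℂ) (Ψ : ℕ → L2 ((Legs P × Leg) × (Leg × Legs Q)))
    (h : SU2) : L2 (Legs P × Legs Q) :=
  ∑' n, α n • gluingMap n h (Ψ n)

end SpinNetwork

end

open SpinNetwork

open SpinNetwork

noncomputable section

namespace SpinNetwork

open ContinuousLinearMap

/-! ### Orthogonal series -/

section Orthogonal

variable {ι E : Type*} [NormedAddCommGroup E] [InnerProductSpace ℂ E]

/-! Everything follows from Schur's lemma at the two vertices. If `w` is invariant at internal spin
`j`, its components along the `2j+1` internal basis vectors are mutually orthogonal with equal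
norms, so they have Gram matrix `⟨w, w'⟩ δ / (2j+1)`; components at different internal spins are
orthogonal (`inner_coslice`, `inner_coslice_of_ne` at the right vertex, `inner_slice`,
`inner_slice_of_ne` at the left).

At `v₂` this gives claims 1 and 2. Matrix entries of a reduced density are inner products of vectors
at `v₂`. In those of the glued state the factor `√(2j+1)²` cancels Schur's `1/(2j+1)`, and unitarity
of `D^j(h)` removes `h`, leaving the trace over the internal leg (`inner_coslice_gluingMap`).

At `v₁` it gives claim 3. The maps `√(2j+1) ⟨j,m|` on intertwiners are partial isometries with
orthogonal ranges (`inner_legIsometry`), so the boundary density is an orthogonal sum over `(j,m)`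
of copies of `p_j ρ^j / (2j+1)`. Entropy is additive over such sums (`tsum_cfc_of_hasSum`), and for
trace one `S(cρ) = -c ln c + c S(ρ)`; the `2j+1` equal copies produce `p_j ln(2j+1) - p_j ln p_j +
p_j S(ρ^j)`. All sums live in `[0, ∞]`, so infinite entropies need no separate treatment. -/

theorem summable_of_pairwise_orthogonal [CompleteSpace E] {v : ι → E}
    (hv : ∀ i j, i ≠ j → inner ℂ (v i) (v j) = 0) (hs : Summable fun i => ‖v i‖ ^ 2) :
    Summable v := by
  have hV : OrthogonalFamily ℂ (fun i => (ℂ ∙ v i : Submodule ℂ E))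
      (fun i => (ℂ ∙ v i : Submodule ℂ E).subtypeₗᵢ) := by
    intro i j hij a b
    obtain ⟨c, hc⟩ := Submodule.mem_span_singleton.1 a.2
    obtain ⟨d, hd⟩ := Submodule.mem_span_singleton.1 b.2
    simp [← hc, ← hd, inner_smul_left, inner_smul_right, hv i j hij]
  exact (hV.summable_iff_norm_sq_summable
    (fun i => ⟨v i, Submodule.mem_span_singleton_self _⟩)).2 hs

/-- Only orthogonality between the two families is needed, not within either. This removes the cross
terms between internal spins from Gram entries of superpositions. -/
theorem hasSum_inner_of_orthogonal {a b : ι → E} {A B : E} (ha : HasSum a A) (hb : HasSum b B)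
    (hab : ∀ i j, i ≠ j → inner ℂ (a i) (b j) = 0) :
    HasSum (fun i => inner ℂ (a i) (b i)) (inner ℂ A B) := by
  have h1 : ∀ i, inner ℂ (a i) B = inner ℂ (a i) (b i) := fun i =>
    (hb.mapL (innerSL ℂ (a i))).unique (hasSum_single i fun j hj => hab i j hj.symm)
  have h2 := (ha.mapL (innerSL ℂ B)).map (starRingEnd ℂ) Complex.continuous_conj
  simpa [Function.comp_def, h1] using h2

end Orthogonal

/-! ### Coordinates of square-summable families -/

variable {X Y Z : Type}

open scoped Classical in
/-- The distinguished basis vector with index `x`. -/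
def ket (x : X) : L2 X := lp.single 2 x (1 : ℂ)

theorem inner_ket (x : X) (u : L2 X) : inner ℂ (ket x) u = u x := by
  classical
  rw [ket, lp.inner_single_left]; simp

@[simp] theorem slice_apply (y : Y) (u : L2 (X × Y)) (x : X) : slice y u x = u (x, y) := rfl

theorem hasSum_ket (u : L2 X) : HasSum (fun x => u x • ket x) u := by
  classical
  refine (lp.hasSum_single (by norm_num) u).congr_fun ?_
  intro x
  rw [ket, ← lp.single_smul]; simp

theorem clm_ext {F : Type*} [NormedAddCommGroup F] [NormedSpace ℂ F] {A B : L2 X →L[ℂ] F}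
    (h : ∀ x, A (ket x) = B (ket x)) : A = B := by
  ext1 u
  refine ((hasSum_ket u).mapL A).unique ?_
  simpa [h] using (hasSum_ket u).mapL B

theorem clm_ext_apply {A B : L2 X →L[ℂ] L2 Y} (h : ∀ x y, A (ket x) y = B (ket x) y) : A = B :=
  clm_ext fun x => by ext y; exact h x y

theorem hasSum_norm_sq (u : L2 X) : HasSum (fun x => ‖u x‖ ^ 2) (‖u‖ ^ 2) := by
  simpa using lp.hasSum_norm (p := 2) (by norm_num) u

theorem tsum_ofReal_norm_sq (u : L2 X) :
    ∑' x, ENNReal.ofReal (‖u x‖ ^ 2) = ENNReal.ofReal (‖u‖ ^ 2) := by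
  rw [← (hasSum_norm_sq u).tsum_eq,
    ENNReal.ofReal_tsum_of_nonneg (fun _ => by positivity) (hasSum_norm_sq u).summable]

/-- The contraction with the basis vector `x` of the first factor. -/
def coslice (x : X) : L2 (X × Y) →L[ℂ] L2 Y :=
  pullback (fun y => (x, y)) (fun _ _ h => congrArg Prod.snd h)

@[simp] theorem coslice_apply (x : X) (u : L2 (X × Y)) (y : Y) : coslice x u y = u (x, y) := rfl

theorem hasSum_inner_coslice (u v : L2 (X × Y)) :
    HasSum (fun x => inner ℂ (coslice x u) (coslice x v)) (inner ℂ u v) :=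
  (lp.hasSum_inner u v).prod_fiberwise fun x => lp.hasSum_inner (coslice x u) (coslice x v)

theorem hasSum_norm_sq_slice (u : L2 (X × Y)) :
    HasSum (fun y => ‖slice y u‖ ^ 2) (‖u‖ ^ 2) := by
  have h := (Equiv.prodComm Y X).hasSum_iff.2 (hasSum_norm_sq u)
  exact h.prod_fiberwise fun y => hasSum_norm_sq (slice y u)

/-- Reassociation of tensor factors. -/
def assoc : L2 ((X × Y) × Z) →L[ℂ] L2 (X × (Y × Z)) :=
  pullback (Equiv.prodAssoc X Y Z).symm (Equiv.injective _)

theorem norm_assoc (u : L2 ((X × Y) × Z)) : ‖assoc u‖ ^ 2 = ‖u‖ ^ 2 :=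
  (hasSum_norm_sq (assoc u)).unique
    ((Equiv.prodAssoc X Y Z).symm.hasSum_iff.2 (hasSum_norm_sq u))

/-! ### Reduced density matrices -/

theorem comp_ketBra_adjoint (A : L2 X →L[ℂ] L2 Y) (u : L2 X) :
    A.comp ((ketBra u).comp (adjoint A)) = ketBra (A u) := by
  simp [ketBra, InnerProductSpace.rankOne_comp, InnerProductSpace.comp_rankOne]

theorem norm_ketBra (u : L2 X) : ‖ketBra u‖ = ‖u‖ ^ 2 := by
  simp [ketBra, sq]

/-- The norms of the terms are `‖slice y u‖ ^ 2`, with sum `‖u‖ ^ 2`; hence the partial trace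
converges in operator norm. -/
theorem summable_ketBra_slice (u : L2 (X × Y)) : Summable fun y => ketBra (slice y u) := by
  refine Summable.of_norm ?_
  simpa [norm_ketBra] using (hasSum_norm_sq_slice u).summable

theorem hasSum_reducedDensity (u : L2 (X × Y)) :
    HasSum (fun y => ketBra (slice y u)) (reducedDensity u) := by
  have h := (summable_ketBra_slice u).hasSum
  simpa only [reducedDensity, partialTrace, comp_ketBra_adjoint] using h

theorem norm_reducedDensity_le (u : L2 (X × Y)) : ‖reducedDensity u‖ ≤ ‖u‖ ^ 2 := by
  rw [← (hasSum_reducedDensity u).tsum_eq]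
  refine tsum_of_norm_bounded (hasSum_norm_sq_slice u) fun y => (norm_ketBra _).le

/-- A reduced density is a Gram matrix of coslices, so identities between reduced densities become
identities between inner products. -/
theorem reducedDensity_ket (u : L2 (X × Y)) (x x' : X) :
    reducedDensity u (ket x') x = inner ℂ (coslice x' u) (coslice x u) := by
  have h := (hasSum_reducedDensity u).mapL
    ((innerSL ℂ (ket x)).comp (ContinuousLinearMap.apply ℂ (L2 X) (ket x')))
  have h' := lp.hasSum_inner (𝕜 := ℂ) (coslice x' u) (coslice x u)
  simp only [comp_apply, apply_apply, innerSL_apply_apply, inner_ket] at h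
  refine h.unique (h'.congr_fun fun y => ?_)
  have : inner ℂ (slice y u) (ket x') = (starRingEnd ℂ) (u (x', y)) := by
    rw [← inner_conj_symm, inner_ket, slice_apply]
  simp [ketBra, this, mul_comm]

theorem isPositive_reducedDensity (u : L2 (X × Y)) : (reducedDensity u).IsPositive := by
  have h := hasSum_reducedDensity u
  rw [← nonneg_iff_isPositive, ← h.tsum_eq]
  exact tsum_nonneg fun y => (nonneg_iff_isPositive _).2
    (InnerProductSpace.isPositive_rankOne_self _)

theorem hasSum_partialTrace_reducedDensity (u : L2 ((X × Y) × Z)) :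
    HasSum (fun y => (slice y).comp ((reducedDensity u).comp (adjoint (slice y))))
      (reducedDensity (assoc u)) := by
  refine (hasSum_reducedDensity (assoc u)).prod_fiberwise fun y => ?_
  have h := (hasSum_reducedDensity u).mapL
    ((compL ℂ (L2 X) (L2 (X × Y)) (L2 X) (slice y)).comp
      ((compL ℂ (L2 X) (L2 (X × Y)) (L2 (X × Y))).flip (adjoint (slice y))))
  refine h.congr_fun fun z => ?_
  simp only [comp_apply, flip_apply, compL_apply, comp_ketBra_adjoint]
  rfl

theorem partialTrace_reducedDensity (u : L2 ((X × Y) × Z)) :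
    partialTrace (reducedDensity u) = reducedDensity (assoc u) :=
  (hasSum_partialTrace_reducedDensity u).tsum_eq

/-- The trace of a reduced density matrix. -/
theorem tsum_reducedDensity_diag (u : L2 (X × Y)) :
    ∑' x, ENNReal.ofReal (reducedDensity u (ket x) x).re = ENNReal.ofReal (‖u‖ ^ 2) := by
  have h := (hasSum_inner_coslice u u).mapL Complex.reCLM
  have h1 : ∀ {W : Type} (w : L2 W), (inner ℂ w w : ℂ).re = ‖w‖ ^ 2 := fun w => by
    rw [inner_self_eq_norm_sq_to_K]; norm_cast
  simp only [Complex.reCLM_apply, h1] at h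
  simp only [reducedDensity_ket, h1]
  rw [← h.tsum_eq, ENNReal.ofReal_tsum_of_nonneg (fun _ => by positivity) h.summable]

end SpinNetwork

namespace SpinNetwork

open Matrix Polynomial

/-! ### Matrices of the representations of `SU(2)` -/

theorem binomial_sum {R : Type*} [CommSemiring R] (n : ℕ) (x y : R) :
    ∑ l : Fin (n + 1), (n.choose l : R) * (x ^ (l : ℕ) * y ^ (n - (l : ℕ))) = (x + y) ^ n := by
  rw [add_pow, Finset.sum_range]
  exact Finset.sum_congr rfl fun l _ => by ring

/-- The coefficients of the coherent state with parameter `t`. -/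
def coherent (n : ℕ) (t : ℂ) (l : Fin (n + 1)) : ℂ := (Real.sqrt (n.choose l) : ℝ) * t ^ (l : ℕ)

theorem sqrt_choose_ne_zero (n : ℕ) (l : Fin (n + 1)) : ((Real.sqrt (n.choose l) : ℝ) : ℂ) ≠ 0 := by
  have : 0 < n.choose l := Nat.choose_pos (Nat.le_of_lt_succ l.2)
  exact_mod_cast (Real.sqrt_pos.2 (by exact_mod_cast this)).ne'

theorem sqrt_choose_mul_self (n l : ℕ) :
    ((Real.sqrt (n.choose l) : ℝ) : ℂ) * (Real.sqrt (n.choose l) : ℝ) = n.choose l := by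
  rw [← Complex.ofReal_mul, Real.mul_self_sqrt (by positivity)]; simp

theorem coeff_linear_pow (n : ℕ) (x y : ℂ) (k : ℕ) :
    ((C x * X + C y) ^ n : ℂ[X]).coeff k = n.choose k * (x ^ k * y ^ (n - k)) := by
  have : ((C x * X + C y) ^ n : ℂ[X]) = ((X + C y) ^ n).comp (C x * X) := by simp
  rw [this, comp_C_mul_X_coeff, coeff_X_add_C_pow]
  ring

/-- `coherent n t` represents the polynomial `(t x + y) ^ n`, and `g` acts by linear substitution,
so the image is again the `n`-th power of a linear form. -/
theorem wignerD_mulVec_coherent (n : ℕ) (g : SU2) (t : ℂ) (k : Fin (n + 1)) :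
    (wignerD n g *ᵥ coherent n t) k = (Real.sqrt (n.choose k) : ℝ) *
      ((g.1 0 0 * t + g.1 0 1) ^ (k : ℕ) * (g.1 1 0 * t + g.1 1 1) ^ (n - (k : ℕ))) := by
  have h := congrArg (fun p : ℂ[X] => p.coeff k) (binomial_sum n
    (C t * (C (g.1 0 0) * X + C (g.1 1 0))) (C (g.1 0 1) * X + C (g.1 1 1)))
  have e : C t * (C (g.1 0 0) * X + C (g.1 1 0)) + (C (g.1 0 1) * X + C (g.1 1 1)) =
      C (g.1 0 0 * t + g.1 0 1) * X + C (g.1 1 0 * t + g.1 1 1) := by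
    simp only [C_add, C_mul]; ring
  simp only [e, coeff_linear_pow, finsetSum_coeff] at h
  have hk := sqrt_choose_ne_zero n k
  rw [← mul_right_inj' hk, ← mul_assoc, sqrt_choose_mul_self, ← h, mulVec, dotProduct,
    Finset.mul_sum]
  refine Finset.sum_congr rfl fun l _ => ?_
  rw [mul_pow, ← C_pow, mul_assoc, ← C_eq_natCast, coeff_C_mul, coeff_C_mul, wignerD, coherent,
    ← sqrt_choose_mul_self, Complex.ofReal_div]
  field_simp

/-- Coherent vectors span: evaluation at `t = 0, …, n` gives an invertible Vandermonde system. -/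
theorem eq_zero_of_dotProduct_coherent {n : ℕ} {v : Fin (n + 1) → ℂ}
    (h : ∀ t : ℂ, v ⬝ᵥ coherent n t = 0) : v = 0 := by
  have : (fun l => v l * (Real.sqrt (n.choose l) : ℝ)) = 0 := by
    refine Matrix.eq_zero_of_forall_index_sum_mul_pow_eq_zero
      (f := fun i : Fin (n + 1) => ((i : ℕ) : ℂ))
      (fun i j hij => Fin.ext (Nat.cast_injective hij)) fun j => ?_
    rw [← h j]
    exact Finset.sum_congr rfl fun l _ => mul_assoc _ _ _
  ext l
  exact (mul_eq_zero.1 (congrFun this l)).resolve_right (sqrt_choose_ne_zero n l)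

theorem star_coherent_dotProduct (n : ℕ) (s t : ℂ) :
    star (coherent n s) ⬝ᵥ coherent n t = (star s * t + 1) ^ n := by
  rw [← binomial_sum]
  refine Finset.sum_congr rfl fun l _ => ?_
  simp only [Pi.star_apply, coherent, star_mul', star_pow, RCLike.star_def, Complex.conj_ofReal,
    ← sqrt_choose_mul_self]
  ring

theorem SU2_column_inner (g : SU2) (i j : Fin 2) :
    star (g.1 0 i) * g.1 0 j + star (g.1 1 i) * g.1 1 j = if i = j then 1 else 0 := by
  have h := (mem_unitaryGroup_iff'.1 (mem_specialUnitaryGroup_iff.1 g.2).1)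
  have := congrFun (congrFun h i) j
  simpa [Matrix.mul_apply, Fin.sum_univ_two, Matrix.one_apply, Matrix.star_apply] using this

/-- The overlap of two coherent vectors is the `n`-th power of the inner product of `(s, 1)` and
`(t, 1)` in `ℂ²`, which `g` preserves; spanning does the rest. -/
theorem wignerD_conjTranspose_mul (n : ℕ) (g : SU2) : (wignerD n g)ᴴ * wignerD n g = 1 := by
  rw [← sub_eq_zero]
  set M := (wignerD n g)ᴴ * wignerD n g - 1 with hM
  have h : ∀ s t, star (coherent n s) ⬝ᵥ (M *ᵥ coherent n t) = 0 := by
    intro s t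
    rw [hM, sub_mulVec, one_mulVec, dotProduct_sub, star_coherent_dotProduct, ← mulVec_mulVec,
      dotProduct_mulVec, ← star_mulVec, sub_eq_zero]
    have h00 := SU2_column_inner g 0 0
    have h01 := SU2_column_inner g 0 1
    have h10 := SU2_column_inner g 1 0
    have h11 := SU2_column_inner g 1 1
    have e : star s * t + 1 =
        star (g.1 0 0 * s + g.1 0 1) * (g.1 0 0 * t + g.1 0 1) +
        star (g.1 1 0 * s + g.1 1 1) * (g.1 1 0 * t + g.1 1 1) := by
      simp only [star_add, star_mul'] at *
      simp at h00 h01 h10 h11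
      simp
      linear_combination (-(starRingEnd ℂ) s * t) * h00 - (starRingEnd ℂ) s * h01 - t * h10 - h11
    rw [e, ← binomial_sum]
    refine Finset.sum_congr rfl fun k _ => ?_
    simp only [Pi.star_apply, wignerD_mulVec_coherent, star_mul', star_pow, mul_pow,
      ← sqrt_choose_mul_self]
    simp only [RCLike.star_def, Complex.conj_ofReal]
    ring
  have h2 : ∀ s, Mᴴ *ᵥ coherent n s = 0 := fun s => by
    have := eq_zero_of_dotProduct_coherent (v := star (coherent n s) ᵥ* M) fun t => by
      rw [← dotProduct_mulVec, h]
    rw [← star_eq_zero, star_mulVec, conjTranspose_conjTranspose, this]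
  have h3 : Mᴴ = 0 := by
    ext i j
    exact congrFun (eq_zero_of_dotProduct_coherent (v := Mᴴ i) fun t => congrFun (h2 t) i) j
  exact conjTranspose_eq_zero.1 h3

theorem wignerD_mul_conjTranspose (n : ℕ) (g : SU2) : wignerD n g * (wignerD n g)ᴴ = 1 :=
  mul_eq_one_comm.1 (wignerD_conjTranspose_mul n g)

theorem wignerD_of_diagonal (n : ℕ) (g : SU2) (h01 : g.1 0 1 = 0) (h10 : g.1 1 0 = 0) :
    wignerD n g = diagonal fun k : Fin (n + 1) => g.1 0 0 ^ (k : ℕ) * g.1 1 1 ^ (n - (k : ℕ)) := by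
  ext k l
  rw [wignerD, h01, h10]
  simp only [C_0, add_zero, zero_mul, zero_add, mul_pow, ← C_pow]
  rw [mul_comm (_ * X ^ _), ← mul_assoc, ← C_mul, coeff_C_mul_X_pow, diagonal_apply]
  by_cases hkl : k = l
  · subst hkl
    have hk := sqrt_choose_ne_zero n k
    rw [Complex.ofReal_div, div_self hk]; simp [mul_comm]
  · simp [hkl, Fin.val_inj]

/-- Diagonal elements of `SU(2)`. -/
def phase (θ : ℝ) : SU2 :=
  ⟨!![Complex.exp (θ * Complex.I), 0; 0, Complex.exp (-(θ * Complex.I))], by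
    rw [mem_specialUnitaryGroup_iff, mem_unitaryGroup_iff]
    constructor
    · ext i j
      fin_cases i <;> fin_cases j <;>
        simp [Matrix.mul_apply, Fin.sum_univ_two, Matrix.star_apply, ← Complex.exp_conj,
          ← Complex.exp_add]
    · simp [det_fin_two, ← Complex.exp_add]⟩

/-- An element of `SU(2)` without zero entries. -/
def rotation : SU2 :=
  ⟨!![3 / 5, -4 / 5; 4 / 5, 3 / 5], by
    rw [mem_specialUnitaryGroup_iff, mem_unitaryGroup_iff]
    constructor
    · ext i j
      fin_cases i <;> fin_cases j <;>
        simp [Matrix.mul_apply, Fin.sum_univ_two, Matrix.star_apply, Complex.conj_ofNat] <;> norm_num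
    · simp [det_fin_two]; norm_num⟩

theorem wignerD_phase (n : ℕ) (θ : ℝ) : wignerD n (phase θ) =
    diagonal fun k : Fin (n + 1) => Complex.exp (((2 * (k : ℕ) - n : ℝ) * θ : ℝ) * Complex.I) := by
  rw [wignerD_of_diagonal n _ (by simp [phase]) (by simp [phase])]
  congr 1
  ext k
  have : ((n - (k : ℕ) : ℕ) : ℂ) = n - (k : ℕ) := Nat.cast_sub (Nat.le_of_lt_succ k.2)
  simp only [phase, of_apply, cons_val_zero, cons_val_one, cons_val', cons_val_fin_one,
    ← Complex.exp_nat_mul, ← Complex.exp_add, this]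
  congr 1; push_cast; ring

/-- Row `0` consists of constant coefficients, which are multiples of products of powers of `4 / 5`
and `3 / 5`. The column version below serves the transposed family. -/
theorem wignerD_rotation_zero_left (n : ℕ) (l : Fin (n + 1)) : wignerD n rotation 0 l ≠ 0 := by
  have := sqrt_choose_ne_zero n l
  simp [wignerD, rotation, coeff_zero_eq_eval_zero, this]

theorem wignerD_rotation_zero_right (n : ℕ) (k : Fin (n + 1)) : wignerD n rotation k 0 ≠ 0 := by
  have h2 : n.choose k ≠ 0 := (Nat.choose_pos (Nat.le_of_lt_succ k.2)).ne'
  have := coeff_linear_pow n (-4 / 5) (3 / 5) k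
  simp [wignerD, rotation] at this ⊢
  simp [this, h2]

/-! ### Schur orthogonality -/

/-- The properties of the family of representations of `SU(2)` that enter Schur's lemma. They are
shared by the matrices `wignerD n g` and their transposes. -/
structure IsSpinFamily (A : ∀ n, SU2 → Matrix (Fin (n + 1)) (Fin (n + 1)) ℂ) : Prop where
  conjTranspose_mul : ∀ n g, (A n g)ᴴ * A n g = 1
  phase : ∀ n θ, A n (phase θ) =
    diagonal fun k : Fin (n + 1) => Complex.exp (((2 * (k : ℕ) - n : ℝ) * θ : ℝ) * Complex.I)
  rotation : ∀ n l, A n rotation 0 l ≠ 0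

theorem isSpinFamily_wignerD : IsSpinFamily wignerD :=
  ⟨wignerD_conjTranspose_mul, wignerD_phase, wignerD_rotation_zero_left⟩

theorem isSpinFamily_wignerD_transpose : IsSpinFamily fun n g => (wignerD n g)ᵀ := by
  refine ⟨fun n g => ?_, fun n θ => ?_, fun n l => wignerD_rotation_zero_right n l⟩
  · change (wignerD n g)ᴴᵀ * (wignerD n g)ᵀ = 1
    rw [← transpose_mul, wignerD_mul_conjTranspose, transpose_one]
  · rw [wignerD_phase, diagonal_transpose]

namespace IsSpinFamily

variable {A : ∀ n, SU2 → Matrix (Fin (n + 1)) (Fin (n + 1)) ℂ}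

/-- Intertwiners preserve the weight. -/
theorem weight_eq (hA : IsSpinFamily A) {n n' : ℕ} {G : Matrix (Fin (n + 1)) (Fin (n' + 1)) ℂ}
    (hG : ∀ g, (A n g)ᵀ * G = G * (A n' g)ᵀ) {k : Fin (n + 1)} {l : Fin (n' + 1)}
    (hkl : G k l ≠ 0) : (2 * (k : ℕ) - n : ℤ) = 2 * (l : ℕ) - n' := by
  by_contra hne
  set d : ℝ := (2 * (k : ℕ) - n : ℝ) - (2 * (l : ℕ) - n') with hd
  have hd0 : d ≠ 0 := by
    rw [hd, sub_ne_zero]; exact_mod_cast hne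
  -- The angle `π / d` makes the relative phase of the two weights `exp (iπ) = -1`.
  have h := congrFun (congrFun (hG (SpinNetwork.phase (Real.pi / d))) k) l
  rw [hA.phase, hA.phase, diagonal_transpose, diagonal_transpose, diagonal_mul, mul_diagonal,
    mul_comm, mul_right_inj' hkl, ← div_eq_one_iff_eq (Complex.exp_ne_zero _), ← Complex.exp_sub,
    ← sub_mul, ← Complex.ofReal_sub, ← sub_mul, ← hd, mul_div_cancel₀ _ hd0,
    Complex.exp_pi_mul_I] at h
  norm_num at h

/-- The weight `-n'` of column `0` does not occur in spin `n / 2`, so that column vanishes. If `G k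
l ≠ 0`, then `l` is the only nonzero position in row `k`, and the `(k, 0)` entry of the relation at
`rotation` reads `0 = G k l * A n' rotation 0 l`, impossible. -/
theorem eq_zero (hA : IsSpinFamily A) {n n' : ℕ} (hn : n < n')
    {G : Matrix (Fin (n + 1)) (Fin (n' + 1)) ℂ}
    (hG : ∀ g, (A n g)ᵀ * G = G * (A n' g)ᵀ) : G = 0 := by
  ext k l
  by_contra hkl
  have h := congrFun (congrFun (hG SpinNetwork.rotation) k) 0
  have hw := hA.weight_eq hG hkl
  rw [mul_apply, mul_apply, Finset.sum_eq_zero, Finset.sum_eq_single l] at h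
  · exact mul_ne_zero hkl (hA.rotation n' l) h.symm
  · intro j _ hj
    by_contra h0
    have := hA.weight_eq hG (left_ne_zero_of_mul h0)
    exact hj (Fin.ext (by omega))
  · simp
  · intro i _
    by_contra h0
    have := hA.weight_eq hG (right_ne_zero_of_mul h0)
    rw [Fin.val_zero] at this
    omega

/-- Weights make `G` diagonal; the `(k, 0)` entry at `rotation`, whose row `0` has no zeros, equates
`G k k` with `G 0 0`. -/
theorem eq_scalar (hA : IsSpinFamily A) {n : ℕ} {G : Matrix (Fin (n + 1)) (Fin (n + 1)) ℂ}
    (hG : ∀ g, (A n g)ᵀ * G = G * (A n g)ᵀ) : G = diagonal fun _ => G 0 0 := by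
  have hdiag : G = diagonal fun k => G k k := by
    ext k l
    rw [diagonal_apply]
    split_ifs with hkl
    · rw [hkl]
    · by_contra h0
      have := hA.weight_eq hG h0
      exact hkl (Fin.ext (by omega))
  have h : ∀ k, G k k = G 0 0 := fun k => by
    have h := congrFun (congrFun (hG SpinNetwork.rotation) k) 0
    rw [hdiag, mul_diagonal, diagonal_mul, mul_comm] at h
    exact (mul_right_cancel₀ (hA.rotation n k) h).symm
  rw [hdiag]
  simp [h]

end IsSpinFamily

end SpinNetwork

namespace SpinNetwork

open Matrix

/-! ### Gram matrices of intertwiners -/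

section PiKronecker

variable {ι R : Type*} [Fintype ι] [CommRing R] {κ : ι → Type*}

/-- The Kronecker product of a finite family of matrices. -/
def piKronecker (M : ∀ i, Matrix (κ i) (κ i) R) : Matrix (∀ i, κ i) (∀ i, κ i) R :=
  of fun x y => ∏ i, M i (x i) (y i)

theorem piKronecker_mul [DecidableEq ι] [∀ i, Fintype (κ i)] (M N : ∀ i, Matrix (κ i) (κ i) R) :
    piKronecker M * piKronecker N = piKronecker fun i => M i * N i := by
  ext x y
  simp only [piKronecker, mul_apply, of_apply, ← Finset.prod_mul_distrib,
    Finset.prod_univ_sum, Fintype.piFinset_univ]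

theorem piKronecker_one [∀ i, DecidableEq (κ i)] [DecidableEq (∀ i, κ i)] :
    piKronecker (fun i => (1 : Matrix (κ i) (κ i) R)) = 1 := by
  ext x y
  simp only [piKronecker, of_apply, one_apply, Finset.prod_boole, Finset.mem_univ, true_imp_iff,
    funext_iff]

theorem piKronecker_conjTranspose [StarRing R] (M : ∀ i, Matrix (κ i) (κ i) R) :
    (piKronecker M)ᴴ = piKronecker fun i => (M i)ᴴ := by
  ext x y
  simp [piKronecker, conjTranspose_apply]

end PiKronecker

namespace IsSpinFamily

variable {A : ∀ n, SU2 → Matrix (Fin (n + 1)) (Fin (n + 1)) ℂ}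

/-- `Vᴴᵀ * V'ᵀ` is the matrix of inner products of the rows of `V` and `V'`. The unitary `W` on the
boundary legs cancels, leaving only the action on the internal index. -/
theorem gram_intertwines (hA : IsSpinFamily A) {K : Type*} [Fintype K] [DecidableEq K] {n n' : ℕ}
    {V : Matrix (Fin (n + 1)) K ℂ} {V' : Matrix (Fin (n' + 1)) K ℂ} {g : SU2} {W : Matrix K K ℂ}
    (hW : Wᴴ * W = 1) (hV : V = A n g * V * Wᵀ) (hV' : V' = A n' g * V' * Wᵀ) :
    (A n g)ᵀ * (Vᴴᵀ * V'ᵀ) = Vᴴᵀ * V'ᵀ * (A n' g)ᵀ := by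
  have h1 : Vᴴᵀ = (A n g)ᴴᵀ * Vᴴᵀ * Wᴴ := by
    conv_lhs => rw [hV]
    rw [Matrix.conjTranspose_mul, Matrix.conjTranspose_mul, transpose_mul, transpose_mul]
    rfl
  have h2 : V'ᵀ = W * V'ᵀ * (A n' g)ᵀ := by
    conv_lhs => rw [hV']
    simp only [transpose_mul, transpose_transpose, Matrix.mul_assoc]
  have h3 : (A n g)ᵀ * (A n g)ᴴᵀ = 1 := by
    rw [← transpose_mul, hA.conjTranspose_mul, transpose_one]
  calc (A n g)ᵀ * (Vᴴᵀ * V'ᵀ)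
      = (A n g)ᵀ * (((A n g)ᴴᵀ * Vᴴᵀ * Wᴴ) * (W * V'ᵀ * (A n' g)ᵀ)) := by rw [← h1, ← h2]
    _ = ((A n g)ᵀ * (A n g)ᴴᵀ) * Vᴴᵀ * (Wᴴ * W) * V'ᵀ * (A n' g)ᵀ := by
        simp only [Matrix.mul_assoc]
    _ = _ := by rw [h3, hW]; simp only [Matrix.mul_assoc, Matrix.one_mul]

end IsSpinFamily

/-- Decomposition of the product basis of `⨂_I ⨁_j V^j` according to the spins. -/
def legsEquiv (P : ℕ) : (Σ s : Fin P → ℕ, ∀ I, Fin (s I + 1)) ≃ Legs P where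
  toFun p I := ⟨p.1 I, p.2 I⟩
  invFun x := ⟨fun I => (x I).1, fun I => (x I).2⟩
  left_inv _ := rfl
  right_inv _ := rfl

/-- The components at boundary spins `s` of the vectors `v 0, …, v n`. -/
def spinBlock {P n : ℕ} (v : Fin (n + 1) → L2 (Legs P)) (s : Fin P → ℕ) :
    Matrix (Fin (n + 1)) (∀ I, Fin (s I + 1)) ℂ :=
  of fun m k => v m (legsEquiv P ⟨s, k⟩)

/-- Fixing the boundary spins makes each block finite-dimensional, so Schur's lemma is applied block
by block before summing. -/
theorem hasSum_gram {P n n' : ℕ} (v : Fin (n + 1) → L2 (Legs P)) (v' : Fin (n' + 1) → L2 (Legs P))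
    (m : Fin (n + 1)) (m' : Fin (n' + 1)) :
    HasSum (fun s => ((spinBlock v s)ᴴᵀ * (spinBlock v' s)ᵀ) m m') (inner ℂ (v m) (v' m')) := by
  have h := (legsEquiv P).hasSum_iff.2 (lp.hasSum_inner (𝕜 := ℂ) (v m) (v' m'))
  refine (h.sigma fun s => hasSum_fintype _).congr_fun fun s => ?_
  simp [mul_apply, spinBlock, mul_comm]

/-- The components `v m` of a tensor form an invariant tensor, for the representation `A` on the
index `m` and unitary representations `W` on the boundary legs. -/
def IsCovariant {P : ℕ} (A : ∀ n, SU2 → Matrix (Fin (n + 1)) (Fin (n + 1)) ℂ)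
    (W : SU2 → ∀ s : Fin P → ℕ, Matrix (∀ I, Fin (s I + 1)) (∀ I, Fin (s I + 1)) ℂ)
    {n : ℕ} (v : Fin (n + 1) → L2 (Legs P)) : Prop :=
  ∀ g s, spinBlock v s = A n g * spinBlock v s * (W g s)ᵀ

section Covariant

variable {P : ℕ} {A : ∀ n, SU2 → Matrix (Fin (n + 1)) (Fin (n + 1)) ℂ}
  {W : SU2 → ∀ s : Fin P → ℕ, Matrix (∀ I, Fin (s I + 1)) (∀ I, Fin (s I + 1)) ℂ}

theorem IsCovariant.inner_eq_zero (hA : IsSpinFamily A) (hW : ∀ g s, (W g s)ᴴ * W g s = 1)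
    {n n' : ℕ} (hn : n ≠ n') {v : Fin (n + 1) → L2 (Legs P)} {v' : Fin (n' + 1) → L2 (Legs P)}
    (hv : IsCovariant A W v) (hv' : IsCovariant A W v') (m : Fin (n + 1)) (m' : Fin (n' + 1)) :
    inner ℂ (v m) (v' m') = 0 := by
  -- `eq_zero` treats one ordering of the spins; the other follows by conjugate symmetry.
  wlog hlt : n < n' generalizing n n'
  · rw [← inner_conj_symm, this hn.symm hv' hv m' m (by omega), map_zero]
  refine (hasSum_gram v v' m m').unique (hasSum_zero.congr_fun fun s => ?_)
  rw [hA.eq_zero hlt fun g => hA.gram_intertwines (hW g s) (hv g s) (hv' g s)]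
  rfl

theorem IsCovariant.inner_eq (hA : IsSpinFamily A) (hW : ∀ g s, (W g s)ᴴ * W g s = 1)
    {n : ℕ} {v v' : Fin (n + 1) → L2 (Legs P)}
    (hv : IsCovariant A W v) (hv' : IsCovariant A W v') (m m' : Fin (n + 1)) :
    inner ℂ (v m) (v' m') = if m = m' then (inner ℂ (v 0) (v' 0) : ℂ) else 0 := by
  have h : ∀ s, (spinBlock v s)ᴴᵀ * (spinBlock v' s)ᵀ =
      diagonal fun _ => ((spinBlock v s)ᴴᵀ * (spinBlock v' s)ᵀ) 0 0 := fun s =>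
    hA.eq_scalar fun g => hA.gram_intertwines (hW g s) (hv g s) (hv' g s)
  have h1 := hasSum_gram v v' m m'
  split_ifs with hm
  · refine h1.unique ((hasSum_gram v v' 0 0).congr_fun fun s => ?_)
    rw [h s, hm]; simp
  · refine h1.unique (hasSum_zero.congr_fun fun s => ?_)
    rw [h s, diagonal_apply_ne _ hm]

end Covariant

theorem eq_sum_of_hasSum_leg {F : Leg → ℂ} {S : ℂ} {n : ℕ} (hF : HasSum F S)
    (h0 : ∀ e, e.1 ≠ n → F e = 0) : S = ∑ m, F ⟨n, m⟩ := by
  have hinj : Function.Injective fun m : Fin (n + 1) => (⟨n, m⟩ : Leg) :=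
    fun m m' h => by simpa using h
  refine ((hinj.hasSum_iff ?_).2 hF).unique (hasSum_fintype _)
  rintro ⟨k, m⟩ he
  refine h0 _ fun hk => he ?_
  subst hk
  exact ⟨m, rfl⟩

theorem wignerD_transpose_conjTranspose_mul (n : ℕ) (g : SU2) :
    (wignerD n g)ᵀᴴ * (wignerD n g)ᵀ = 1 :=
  isSpinFamily_wignerD_transpose.conjTranspose_mul n g

/-! #### The right vertex -/

section Right

variable {Q n n' : ℕ}

theorem rightIntertwiners_isCovariant {w : L2 (Leg × Legs Q)} (hw : w ∈ rightIntertwiners Q n) :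
    IsCovariant wignerD (fun g s => piKronecker fun J => (wignerD (s J) g⁻¹)ᵀ)
      fun m : Fin (n + 1) => coslice ⟨n, m⟩ w := by
  intro g s
  ext m k
  have h := hw.1 g (⟨n, m⟩, legsEquiv Q ⟨s, k⟩)
  rw [spinBlock, of_apply, coslice_apply, ← h, actRight]
  simp only [mul_apply, Finset.sum_mul]
  rw [Finset.sum_comm]
  refine Finset.sum_congr rfl fun l _ => Finset.sum_congr rfl fun m' _ => ?_
  simp only [piKronecker, transpose_apply, coslice_apply]
  rw [mul_right_comm]
  rfl

theorem coslice_of_mem_right {w : L2 (Leg × Legs Q)} (hw : w ∈ rightIntertwiners Q n) {e : Leg}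
    (he : e.1 ≠ n) : coslice e w = 0 := by
  ext y; exact hw.2 (e, y) he

theorem inner_coslice_of_ne (hn : n ≠ n') {w w' : L2 (Leg × Legs Q)}
    (hw : w ∈ rightIntertwiners Q n) (hw' : w' ∈ rightIntertwiners Q n') (e e' : Leg) :
    inner ℂ (coslice e w) (coslice e' w') = 0 := by
  by_cases he : e.1 = n
  · by_cases he' : e'.1 = n'
    · obtain ⟨_, m⟩ := e
      obtain ⟨_, m'⟩ := e'
      subst he he'
      refine (rightIntertwiners_isCovariant hw).inner_eq_zero isSpinFamily_wignerD ?_ hn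
        (rightIntertwiners_isCovariant hw') m m'
      intro g s
      simp only [piKronecker_conjTranspose, piKronecker_mul, wignerD_transpose_conjTranspose_mul,
        piKronecker_one]
    · rw [coslice_of_mem_right hw' he', inner_zero_right]
  · rw [coslice_of_mem_right hw he, inner_zero_left]

/-- The `n + 1` diagonal Gram entries are equal and add up to `⟨w, w'⟩`. -/
theorem inner_coslice {w w' : L2 (Leg × Legs Q)}
    (hw : w ∈ rightIntertwiners Q n) (hw' : w' ∈ rightIntertwiners Q n) (m m' : Fin (n + 1)) :
    (n + 1 : ℂ) * inner ℂ (coslice ⟨n, m⟩ w) (coslice ⟨n, m'⟩ w') =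
      if m = m' then (inner ℂ w w' : ℂ) else 0 := by
  have h := (rightIntertwiners_isCovariant hw).inner_eq isSpinFamily_wignerD
    (by simp [piKronecker_conjTranspose, piKronecker_mul, wignerD_transpose_conjTranspose_mul,
        piKronecker_one]) (rightIntertwiners_isCovariant hw')
  have h2 := eq_sum_of_hasSum_leg (n := n) (hasSum_inner_coslice w w') fun e he => by
    rw [coslice_of_mem_right hw he, inner_zero_left]
  rw [h2, Finset.sum_congr rfl fun k _ => (h k k).trans (if_pos rfl), h m m']
  split_ifs <;> simp

end Right

/-! #### The left vertex -/

section Left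

variable {P n n' : ℕ}

theorem hasSum_inner_slice {X Y : Type} (u v : L2 (X × Y)) :
    HasSum (fun y => inner ℂ (slice y u) (slice y v)) (inner ℂ u v) :=
  ((Equiv.prodComm Y X).hasSum_iff.2 (lp.hasSum_inner u v)).prod_fiberwise
    fun y => lp.hasSum_inner (slice y u) (slice y v)

theorem leftIntertwiners_isCovariant {u : L2 (Legs P × Leg)} (hu : u ∈ leftIntertwiners P n) :
    IsCovariant (fun n g => (wignerD n g)ᵀ) (fun g s => piKronecker fun I => wignerD (s I) g⁻¹)
      fun m : Fin (n + 1) => slice ⟨n, m⟩ u := by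
  intro g s
  ext m k
  -- The internal leg is dual, so invariance is used at `g⁻¹` to put `(wignerD n g)ᵀ` on it.
  have h := hu.1 g⁻¹ (legsEquiv P ⟨s, k⟩, ⟨n, m⟩)
  rw [spinBlock, of_apply, slice_apply, ← h, actLeft]
  simp only [mul_apply, Finset.sum_mul]
  refine Finset.sum_congr rfl fun l _ => Finset.sum_congr rfl fun m' _ => ?_
  simp only [piKronecker, transpose_apply, slice_apply, inv_inv]
  rw [mul_rotate]
  rfl

theorem slice_of_mem_left {u : L2 (Legs P × Leg)} (hu : u ∈ leftIntertwiners P n) {e : Leg}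
    (he : e.1 ≠ n) : slice e u = 0 := by
  ext x; exact hu.2 (x, e) he

theorem inner_slice_of_ne (hn : n ≠ n') {u u' : L2 (Legs P × Leg)}
    (hu : u ∈ leftIntertwiners P n) (hu' : u' ∈ leftIntertwiners P n') (e e' : Leg) :
    inner ℂ (slice e u) (slice e' u') = 0 := by
  by_cases he : e.1 = n
  · by_cases he' : e'.1 = n'
    · obtain ⟨_, m⟩ := e
      obtain ⟨_, m'⟩ := e'
      subst he he'
      refine (leftIntertwiners_isCovariant hu).inner_eq_zero isSpinFamily_wignerD_transpose ?_ hn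
        (leftIntertwiners_isCovariant hu') m m'
      intro g s
      simp only [piKronecker_conjTranspose, piKronecker_mul, wignerD_conjTranspose_mul,
        piKronecker_one]
    · rw [slice_of_mem_left hu' he', inner_zero_right]
  · rw [slice_of_mem_left hu he, inner_zero_left]

theorem inner_slice {u u' : L2 (Legs P × Leg)}
    (hu : u ∈ leftIntertwiners P n) (hu' : u' ∈ leftIntertwiners P n) (m m' : Fin (n + 1)) :
    (n + 1 : ℂ) * inner ℂ (slice ⟨n, m⟩ u) (slice ⟨n, m'⟩ u') =
      if m = m' then (inner ℂ u u' : ℂ) else 0 := by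
  have h := (leftIntertwiners_isCovariant hu).inner_eq isSpinFamily_wignerD_transpose
    (by simp [piKronecker_conjTranspose, piKronecker_mul, wignerD_conjTranspose_mul,
        piKronecker_one]) (leftIntertwiners_isCovariant hu')
  have h2 := eq_sum_of_hasSum_leg (n := n) (hasSum_inner_slice u u') fun e he => by
    rw [slice_of_mem_left hu he, inner_zero_left]
  rw [h2, Finset.sum_congr rfl fun k _ => (h k k).trans (if_pos rfl), h m m']
  split_ifs <;> simp

end Left

end SpinNetwork

namespace SpinNetwork

open ContinuousLinearMap

/-! ### Functional calculus and intertwining operators -/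

section Intertwine

variable {H K : Type*} [NormedAddCommGroup H] [InnerProductSpace ℂ H]
  [NormedAddCommGroup K] [InnerProductSpace ℂ K]

theorem inner_self_eq_ofReal (x : H) : inner ℂ x x = ((‖x‖ ^ 2 : ℝ) : ℂ) := by
  rw [inner_self_eq_norm_sq_to_K]; norm_cast

theorem tsum_ofReal_norm_sq_inner {X : Type} (b : HilbertBasis X ℂ H) (v : H) :
    ∑' x, ENNReal.ofReal (‖inner ℂ (b x) v‖ ^ 2) = ENNReal.ofReal (‖v‖ ^ 2) := by
  rw [← b.repr.norm_map v, ← tsum_ofReal_norm_sq]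
  simp only [b.repr_apply_apply]

theorem aeval_comp_of_intertwine {a : H →L[ℂ] H} {b : K →L[ℂ] K} {W : K →L[ℂ] H}
    (h : a.comp W = W.comp b) (q : Polynomial ℝ) :
    (Polynomial.aeval a q).comp W = W.comp (Polynomial.aeval b q) := by
  induction q using Polynomial.induction_on' with
  | add p q hp hq => simp [add_comp, comp_add, hp, hq]
  | monomial n c =>
    have hpow : (a ^ n).comp W = W.comp (b ^ n) := by
      induction n with
      | zero => rfl
      | succ n ih =>
        rw [pow_succ, pow_succ', mul_def, mul_def, comp_assoc, h, ← comp_assoc, ih, comp_assoc]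
        rw [← mul_def, ← mul_def, ← pow_succ, ← pow_succ']
    rw [Polynomial.aeval_monomial, Polynomial.aeval_monomial, Algebra.algebraMap_eq_smul_one,
      Algebra.algebraMap_eq_smul_one, smul_mul_assoc, one_mul, smul_mul_assoc, one_mul,
      smul_comp, hpow]
    ext x
    simp

variable [CompleteSpace H] [CompleteSpace K]

theorem norm_cfc_sub_aeval_le {a : H →L[ℂ] H} (ha : IsSelfAdjoint a) {f : ℝ → ℝ}
    (hf : Continuous f) {q : Polynomial ℝ} {ε : ℝ} (hε : 0 ≤ ε)
    (hq : ∀ x ∈ spectrum ℝ a, |q.eval x - f x| ≤ ε) : ‖Polynomial.aeval a q - cfc f a‖ ≤ ε := by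
  rw [← cfc_polynomial q a, ← cfc_sub _ _ a]
  exact norm_cfc_le hε hq

/-- True for polynomials by induction; then Weierstrass approximation on an interval containing both
spectra. -/
theorem cfc_comp_of_intertwine {a : H →L[ℂ] H} {b : K →L[ℂ] K} {W : K →L[ℂ] H}
    (ha : IsSelfAdjoint a) (hb : IsSelfAdjoint b) (h : a.comp W = W.comp b) {f : ℝ → ℝ}
    (hf : Continuous f) : (cfc f a).comp W = W.comp (cfc f b) := by
  rw [← sub_eq_zero, ← norm_le_zero_iff]
  refine le_of_forall_pos_le_add fun ε hε => ?_
  obtain ⟨R, hR⟩ := ((spectrum.isCompact (𝕜 := ℝ) a).union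
    (spectrum.isCompact (𝕜 := ℝ) b)).isBounded.subset_closedBall 0
  -- There are two error terms, each at most `‖W‖` times this; the `+ 1` covers `W = 0`.
  have hδ : 0 < ε / (2 * (‖W‖ + 1)) := by positivity
  obtain ⟨q, hq⟩ := exists_polynomial_near_of_continuousOn (-R) R f hf.continuousOn _ hδ
  have hmem : ∀ x ∈ spectrum ℝ a ∪ spectrum ℝ b, |q.eval x - f x| ≤ ε / (2 * (‖W‖ + 1)) := by
    intro x hx
    have := hR hx
    rw [Real.closedBall_eq_Icc, zero_sub, zero_add] at this
    exact (hq x this).le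
  have h1 := norm_cfc_sub_aeval_le ha hf hδ.le fun x hx => hmem x (Or.inl hx)
  have h2 := norm_cfc_sub_aeval_le hb hf hδ.le fun x hx => hmem x (Or.inr hx)
  have e : (cfc f a).comp W - W.comp (cfc f b) =
      W.comp (Polynomial.aeval b q - cfc f b) - (Polynomial.aeval a q - cfc f a).comp W := by
    rw [comp_sub, sub_comp, aeval_comp_of_intertwine h]; abel
  rw [e, zero_add]
  calc _ ≤ ‖W‖ * (ε / (2 * (‖W‖ + 1))) + ε / (2 * (‖W‖ + 1)) * ‖W‖ := by
        refine (norm_sub_le _ _).trans (add_le_add ?_ ?_)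
        · exact (opNorm_comp_le _ _).trans (by gcongr)
        · exact (opNorm_comp_le _ _).trans (by gcongr)
    _ = ε * (‖W‖ / (‖W‖ + 1)) := by field_simp; ring
    _ ≤ ε * 1 := by
        gcongr
        rw [div_le_one (by positivity)]; linarith
    _ = ε := mul_one ε

theorem cfc_comp_eq_zero {a : H →L[ℂ] H} {W : K →L[ℂ] H} (ha : IsSelfAdjoint a)
    (h : a.comp W = 0) {f : ℝ → ℝ} (hf : Continuous f) (h0 : f 0 = 0) :
    (cfc f a).comp W = 0 := by
  rw [cfc_comp_of_intertwine (b := 0) ha (.zero _) (by simpa using h) hf, cfc_apply_zero, h0]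
  simp

theorem cfc_apply_eq_zero {a : H →L[ℂ] H} (ha : IsSelfAdjoint a) {z : H} (h : a z = 0)
    {f : ℝ → ℝ} (hf : Continuous f) (h0 : f 0 = 0) : cfc f a z = 0 := by
  have := cfc_comp_eq_zero (W := toSpanSingleton ℂ z) ha (by ext; simp [h]) hf h0
  simpa using congrArg (fun T : ℂ →L[ℂ] H => T 1) this

/-- Parseval's identity for a family of partial isometries with orthogonal ranges. -/
theorem hasSum_norm_sq_adjoint {ι : Type*} {W : ι → K →L[ℂ] H} {P : ι → K →L[ℂ] K}
    (hWW : ∀ i, (adjoint (W i)).comp (W i) = P i)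
    (hWW0 : ∀ i j, i ≠ j → (adjoint (W i)).comp (W j) = 0)
    (hWP : ∀ i, (W i).comp (P i) = W i) {v : H}
    (hv : ∀ z, (∀ i, adjoint (W i) z = 0) → inner ℂ v z = 0) :
    HasSum (fun i => ‖adjoint (W i) v‖ ^ 2) (‖v‖ ^ 2) := by
  -- `u i` is the orthogonal projection of `v` onto the range of `W i`.
  let u : ι → H := fun i => W i (adjoint (W i) v)
  have hWu : ∀ i, adjoint (W i) (u i) = adjoint (W i) v := fun i => by
    have := congrArg adjoint (hWP i)
    rw [← hWW, adjoint_comp, adjoint_comp, adjoint_adjoint, comp_assoc] at this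
    exact congrArg (fun T : H →L[ℂ] K => T v) this
  have hWu0 : ∀ i j, i ≠ j → adjoint (W i) (u j) = 0 := fun i j hij =>
    congrArg (fun T : K →L[ℂ] K => T (adjoint (W j) v)) (hWW0 i j hij)
  have hvu : ∀ i, inner ℂ v (u i) = ((‖adjoint (W i) v‖ ^ 2 : ℝ) : ℂ) := fun i => by
    rw [← adjoint_inner_left, inner_self_eq_ofReal]
  have huu : ∀ i j, i ≠ j → inner ℂ (u i) (u j) = 0 := fun i j hij => by
    rw [← adjoint_inner_right]
    exact (congrArg _ (hWu0 i j hij)).trans (inner_zero_right _)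
  have hnu : ∀ i, ‖u i‖ ^ 2 = ‖adjoint (W i) v‖ ^ 2 := fun i => by
    have h1 := adjoint_inner_right (W i) (adjoint (W i) v) (u i)
    rw [hWu, inner_self_eq_ofReal] at h1
    have h2 := h1.trans (inner_self_eq_ofReal (u i))
    exact (Complex.ofReal_injective h2).symm
  have hbessel : ∀ s : Finset ι, ∑ i ∈ s, ‖u i‖ ^ 2 ≤ ‖v‖ ^ 2 := fun s => by
    have h1 : inner ℂ v (∑ i ∈ s, u i) = ((∑ i ∈ s, ‖u i‖ ^ 2 : ℝ) : ℂ) := by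
      rw [inner_sum, Complex.ofReal_sum]
      exact Finset.sum_congr rfl fun i _ => by rw [hvu, hnu]
    have h2 : inner ℂ (∑ i ∈ s, u i) (∑ i ∈ s, u i) = ((∑ i ∈ s, ‖u i‖ ^ 2 : ℝ) : ℂ) := by
      rw [sum_inner, Complex.ofReal_sum]
      refine Finset.sum_congr rfl fun i hi => ?_
      rw [inner_sum, Finset.sum_eq_single_of_mem i hi fun j _ hj => huu i j hj.symm,
        inner_self_eq_ofReal]
    rw [inner_self_eq_ofReal] at h2
    have h3 := Complex.ofReal_injective h2
    have h4 := norm_inner_le_norm (𝕜 := ℂ) v (∑ i ∈ s, u i)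
    rw [h1, ← h3, Complex.norm_real, Real.norm_of_nonneg (by positivity)] at h4
    rw [← h3]
    nlinarith [sq_nonneg (‖v‖ - ‖∑ i ∈ s, u i‖)]
  have hsum : HasSum u (∑' i, u i) := (summable_of_pairwise_orthogonal huu
    (summable_of_sum_le (fun _ => by positivity) hbessel)).hasSum
  -- The remainder is killed by every `adjoint (W i)`, so `hv` makes it orthogonal to `v`, and
  -- Bessel becomes an equality.
  have hz : inner ℂ v (v - ∑' i, u i) = 0 := hv _ fun i => by
    rw [map_sub, sub_eq_zero, ← hWu i]
    exact (hasSum_single i fun j hj => hWu0 i j hj.symm).unique (hsum.mapL (adjoint (W i)))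
  rw [inner_sub_right, sub_eq_zero, inner_self_eq_ofReal] at hz
  have h1 := hsum.mapL (innerSL ℂ v)
  simp only [innerSL_apply_apply, hvu, ← hz] at h1
  exact Complex.hasSum_ofReal.1 h1

/-! ### Traces -/

variable {X B ι : Type}

/-- Both sides are the same double sum of squared matrix entries, exchanged freely in `[0, ∞]`. -/
theorem tsum_norm_sq_adjoint (b : HilbertBasis X ℂ H) (c : HilbertBasis B ℂ K) (A : K →L[ℂ] H) :
    ∑' x, ENNReal.ofReal (‖adjoint A (b x)‖ ^ 2) = ∑' y, ENNReal.ofReal (‖A (c y)‖ ^ 2) := by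
  simp only [← tsum_ofReal_norm_sq_inner c, ← tsum_ofReal_norm_sq_inner b]
  rw [ENNReal.tsum_comm]
  refine tsum_congr fun y => tsum_congr fun x => ?_
  rw [adjoint_inner_right, ← inner_conj_symm, RCLike.norm_conj]

/-- The trace of a function of an orthogonal sum of operators. -/
theorem tsum_cfc_of_hasSum (e : HilbertBasis X ℂ H) (e' : HilbertBasis B ℂ K)
    {ρ : H →L[ℂ] H} (hρ : IsSelfAdjoint ρ)
    {W : ι → K →L[ℂ] H} {P σ : ι → K →L[ℂ] K}
    (hWW : ∀ i, (adjoint (W i)).comp (W i) = P i)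
    (hWW0 : ∀ i j, i ≠ j → (adjoint (W i)).comp (W j) = 0)
    (hWP : ∀ i, (W i).comp (P i) = W i)
    (hσ : ∀ i, IsSelfAdjoint (σ i)) (hPσ : ∀ i, (P i).comp (σ i) = σ i)
    (hsum : HasSum (fun i => (W i).comp ((σ i).comp (adjoint (W i)))) ρ)
    {f : ℝ → ℝ} (hf : Continuous f) (h0 : f 0 = 0) (hpos : ∀ t ∈ spectrum ℝ ρ, 0 ≤ f t) :
    ∑' x, ENNReal.ofReal (inner ℂ (e x) (cfc f ρ (e x))).re =
      ∑' i, ∑' b, ENNReal.ofReal (inner ℂ (e' b) (cfc f (σ i) (e' b))).re := by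
  have hPadj : ∀ i, adjoint (P i) = P i := fun i => by
    rw [← hWW, adjoint_comp, adjoint_adjoint]
  have hσP : ∀ i, (σ i).comp (P i) = σ i := fun i => by
    have := congrArg adjoint (hPσ i)
    rwa [adjoint_comp, hPadj, (hσ i).adjoint_eq] at this
  have hρW : ∀ i, ρ.comp (W i) = (W i).comp (σ i) := fun i => by
    have h1 := hsum.mapL ((compL ℂ (K) (H) (H)).flip (W i))
    simp only [flip_apply, compL_apply, comp_assoc] at h1
    have h2 := h1.unique (hasSum_single i fun j hj => by rw [hWW0 j i hj, comp_zero, comp_zero])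
    rwa [hWW, hσP] at h2
  have hker : ∀ z, (∀ i, adjoint (W i) z = 0) → ρ z = 0 := fun z hz => by
    refine (hsum.mapL (ContinuousLinearMap.apply ℂ (H) z)).unique
      (hasSum_zero.congr_fun fun i => ?_)
    simp [hz]
  -- With `S = √f(ρ)` every diagonal term is a squared norm, so no trace-class hypothesis is needed.
  set g : ℝ → ℝ := fun t => Real.sqrt (f t) with hg
  have hgc : Continuous g := Real.continuous_sqrt.comp hf
  set S := cfc g ρ with hS
  have hSadj : adjoint S = S := (cfc_predicate g ρ : IsSelfAdjoint S).adjoint_eq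
  have hSS : S.comp S = cfc f ρ := by
    rw [← mul_def, hS, ← cfc_mul g g ρ]
    exact cfc_congr fun t ht => Real.mul_self_sqrt (hpos t ht)
  have hre : ∀ v, (inner ℂ v (cfc f ρ v)).re = ‖S v‖ ^ 2 := fun v => by
    rw [← hSS, comp_apply, ← adjoint_inner_left, hSadj, inner_self_eq_ofReal, Complex.ofReal_re]
  have hparseval : ∀ x, HasSum (fun i => ‖adjoint (W i) (S (e x))‖ ^ 2) (‖S (e x)‖ ^ 2) := by
    intro x
    refine hasSum_norm_sq_adjoint hWW hWW0 hWP fun z hz => ?_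
    rw [← adjoint_inner_right, hSadj, hS, cfc_apply_eq_zero hρ (hker z hz) hgc (by simp [hg, h0]),
      inner_zero_right]
  have hblock : ∀ i, (adjoint (W i)).comp ((cfc f ρ).comp (W i)) = cfc f (σ i) := fun i => by
    rw [cfc_comp_of_intertwine hρ (hσ i) (hρW i) hf, ← comp_assoc, hWW]
    -- `σ i` vanishes on the complement of `P i`; as `f 0 = 0`, so does `f (σ i)`.
    have h1 := cfc_comp_eq_zero (W := 1 - P i) (hσ i)
      (by rw [comp_sub, hσP]; exact sub_self _) hf h0
    rw [comp_sub, sub_eq_zero] at h1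
    have h2 := congrArg adjoint ((mul_one _).symm.trans h1)
    rw [adjoint_comp, hPadj, (cfc_predicate f (σ i) : IsSelfAdjoint _).adjoint_eq] at h2
    exact h2.symm
  have hre' : ∀ i b, (inner ℂ (e' b) (cfc f (σ i) (e' b))).re = ‖S (W i (e' b))‖ ^ 2 := by
    intro i b
    rw [← hblock, comp_apply, adjoint_inner_right, comp_apply, hre]
  calc _ = ∑' x, ∑' i, ENNReal.ofReal (‖adjoint (W i) (S (e x))‖ ^ 2) := by
        refine tsum_congr fun x => ?_
        rw [hre, ← (hparseval x).tsum_eq,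
          ENNReal.ofReal_tsum_of_nonneg (fun _ => by positivity) (hparseval x).summable]
    _ = ∑' i, ∑' x, ENNReal.ofReal (‖adjoint (S.comp (W i)) (e x)‖ ^ 2) := by
        rw [ENNReal.tsum_comm]
        simp only [adjoint_comp, hSadj, comp_apply]
    _ = _ := by
        simp only [tsum_norm_sq_adjoint e e', hre', comp_apply]

end Intertwine

end SpinNetwork

namespace SpinNetwork

open ContinuousLinearMap

/-! ### Slices of intertwiner states -/

theorem continuous_coord {X : Type} (x : X) : Continuous fun u : L2 X => u x :=
  (innerSL ℂ (ket x)).continuous.congr (inner_ket x)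

section Slices

variable {P Q n n' : ℕ}

/-- Each invariance equation involves finitely many coordinates, hence is a closed condition. -/
theorem isClosed_leftIntertwiners (P n : ℕ) :
    IsClosed (leftIntertwiners P n : Set (L2 (Legs P × Leg))) := by
  have h : (leftIntertwiners P n : Set (L2 (Legs P × Leg))) =
      (⋂ g, ⋂ x, {u : L2 (Legs P × Leg) | actLeft g u x = u x}) ∩ ⋂ x, ⋂ (_ : x.2.1 ≠ n),
        {u : L2 (Legs P × Leg) | u x = 0} := by
    ext u
    simp only [Set.mem_inter_iff, Set.mem_iInter]
    rfl
  rw [h]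
  refine (isClosed_iInter fun g => isClosed_iInter fun x => ?_).inter
    (isClosed_iInter fun x => isClosed_iInter fun _ => ?_)
  · refine isClosed_eq ?_ (continuous_coord x)
    exact continuous_finsetSum _ fun _ _ => continuous_finsetSum _ fun _ _ =>
      continuous_const.mul (continuous_coord _)
  · exact isClosed_eq (continuous_coord x) continuous_const

theorem isClosed_rightIntertwiners (Q n : ℕ) :
    IsClosed (rightIntertwiners Q n : Set (L2 (Leg × Legs Q))) := by
  have h : (rightIntertwiners Q n : Set (L2 (Leg × Legs Q))) =
      (⋂ g, ⋂ y, {w : L2 (Leg × Legs Q) | actRight g w y = w y}) ∩ ⋂ y, ⋂ (_ : y.1.1 ≠ n),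
        {w : L2 (Leg × Legs Q) | w y = 0} := by
    ext u
    simp only [Set.mem_inter_iff, Set.mem_iInter]
    rfl
  rw [h]
  refine (isClosed_iInter fun g => isClosed_iInter fun x => ?_).inter
    (isClosed_iInter fun x => isClosed_iInter fun _ => ?_)
  · refine isClosed_eq ?_ (continuous_coord x)
    exact continuous_finsetSum _ fun _ _ => continuous_finsetSum _ fun _ _ =>
      continuous_const.mul (continuous_coord _)
  · exact isClosed_eq (continuous_coord x) continuous_const

variable {Ψ : L2 ((Legs P × Leg) × (Leg × Legs Q))}

/-- A slice of a product vector is a multiple of its left factor; linearity and closedness extend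
this to the closed span. -/
theorem slice_mem_leftIntertwiners (hΨ : Ψ ∈ intertwinerSpace P Q n) (y : Leg × Legs Q) :
    slice y Ψ ∈ leftIntertwiners P n := by
  have h : intertwinerSpace P Q n ≤ (leftIntertwiners P n).comap (slice y).toLinearMap := by
    refine Submodule.topologicalClosure_minimal _ (Submodule.span_le.2 ?_)
      ((isClosed_leftIntertwiners P n).preimage (slice y).continuous)
    rintro Φ ⟨u, hu, w, -, hΦ⟩
    have e : slice y Φ = w y • u := by
      ext x
      rw [slice_apply, hΦ, mul_comm]; rfl
    change slice y Φ ∈ leftIntertwiners P n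
    rw [e]
    exact Submodule.smul_mem _ _ hu
  exact h hΨ

theorem coslice_mem_rightIntertwiners (hΨ : Ψ ∈ intertwinerSpace P Q n) (x : Legs P × Leg) :
    coslice x Ψ ∈ rightIntertwiners Q n := by
  have h : intertwinerSpace P Q n ≤ (rightIntertwiners Q n).comap (coslice x).toLinearMap := by
    refine Submodule.topologicalClosure_minimal _ (Submodule.span_le.2 ?_)
      ((isClosed_rightIntertwiners Q n).preimage (coslice x).continuous)
    rintro Φ ⟨u, -, w, hw, hΦ⟩
    have e : coslice x Φ = u x • w := by
      ext y
      rw [coslice_apply, hΦ]; rfl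
    change coslice x Φ ∈ rightIntertwiners Q n
    rw [e]
    exact Submodule.smul_mem _ _ hw
  exact h hΨ

theorem coslice_of_mem_intertwinerSpace (hΨ : Ψ ∈ intertwinerSpace P Q n) (x : Legs P) {e : Leg}
    (he : e.1 ≠ n) : coslice (x, e) Ψ = 0 := by
  ext y; exact (slice_mem_leftIntertwiners hΨ y).2 (x, e) he

/-- Intertwiner states with distinct internal spins have orthogonal coslices. -/
theorem inner_coslice_intertwiner_of_ne (hn : n ≠ n')
    {Φ : L2 ((Legs P × Leg) × (Leg × Legs Q))}
    (hΨ : Ψ ∈ intertwinerSpace P Q n) (hΦ : Φ ∈ intertwinerSpace P Q n') (x x' : Legs P × Leg) :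
    inner ℂ (coslice x Ψ) (coslice x' Φ) = 0 := by
  refine (hasSum_inner_coslice _ _).unique (hasSum_zero.congr_fun fun e => ?_)
  exact inner_coslice_of_ne hn (coslice_mem_rightIntertwiners hΨ x)
    (coslice_mem_rightIntertwiners hΦ x') e e

theorem coslice_coslice_assoc {X Y Z : Type} (Ψ : L2 ((X × Y) × Z)) (x : X) (y : Y) :
    coslice y (coslice x (assoc Ψ)) = coslice (x, y) Ψ := rfl

theorem hasSum_inner_coslice_assoc {X Y Z : Type} (Ψ Φ : L2 ((X × Y) × Z)) (x x' : X) :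
    HasSum (fun y => inner ℂ (coslice (x, y) Ψ) (coslice (x', y) Φ))
      (inner ℂ (coslice x (assoc Ψ)) (coslice x' (assoc Φ))) := by
  simpa only [coslice_coslice_assoc] using
    hasSum_inner_coslice (coslice x (assoc Ψ)) (coslice x' (assoc Φ))

theorem inner_coslice_assoc_of_ne (hn : n ≠ n') {Φ : L2 ((Legs P × Leg) × (Leg × Legs Q))}
    (hΨ : Ψ ∈ intertwinerSpace P Q n) (hΦ : Φ ∈ intertwinerSpace P Q n') (x x' : Legs P) :
    inner ℂ (coslice x (assoc Ψ)) (coslice x' (assoc Φ)) = 0 :=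
  (hasSum_inner_coslice_assoc Ψ Φ x x').unique (hasSum_zero.congr_fun fun _ =>
    inner_coslice_intertwiner_of_ne hn hΨ hΦ _ _)

theorem inner_intertwiner_of_ne (hn : n ≠ n') {Φ : L2 ((Legs P × Leg) × (Leg × Legs Q))}
    (hΨ : Ψ ∈ intertwinerSpace P Q n) (hΦ : Φ ∈ intertwinerSpace P Q n') :
    inner ℂ Ψ Φ = 0 :=
  (hasSum_inner_coslice Ψ Φ).unique (hasSum_zero.congr_fun fun x =>
    inner_coslice_intertwiner_of_ne hn hΨ hΦ x x)

end Slices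

/-! ### Gluing -/

section Gluing

variable {P Q n n' : ℕ} {Ψ : L2 ((Legs P × Leg) × (Leg × Legs Q))}

theorem coslice_gluingMap (h : SU2) (Ψ : L2 ((Legs P × Leg) × (Leg × Legs Q))) (x : Legs P) :
    coslice x (gluingMap n h Ψ) = ((Real.sqrt (2 * spin n + 1) : ℝ) : ℂ) •
      ∑ m : Fin (n + 1), ∑ m' : Fin (n + 1),
        wignerD n h m m' • coslice ⟨n, m'⟩ (coslice (x, ⟨n, m⟩) Ψ) := by
  simp only [gluingMap, map_smul, map_sum]
  rfl

theorem inner_coslice_gluingMap_of_ne (hn : n ≠ n') (h h' : SU2)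
    {Φ : L2 ((Legs P × Leg) × (Leg × Legs Q))}
    (hΨ : Ψ ∈ intertwinerSpace P Q n) (hΦ : Φ ∈ intertwinerSpace P Q n') (x x' : Legs P) :
    inner ℂ (coslice x (gluingMap n h Ψ)) (coslice x' (gluingMap n' h' Φ)) = 0 := by
  simp only [coslice_gluingMap, inner_smul_left, inner_smul_right, sum_inner, inner_sum,
    inner_coslice_of_ne hn (coslice_mem_rightIntertwiners hΨ _)
      (coslice_mem_rightIntertwiners hΦ _), mul_zero, Finset.sum_const_zero]

theorem sqrt_dim_mul_self (n : ℕ) :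
    ((Real.sqrt (2 * spin n + 1) : ℝ) : ℂ) * (Real.sqrt (2 * spin n + 1) : ℝ) = n + 1 := by
  have : 2 * spin n + 1 = (n : ℝ) + 1 := by rw [spin]; ring
  rw [← Complex.ofReal_mul, this, Real.mul_self_sqrt (by positivity)]
  simp

/-- Gluing with a holonomy traces out the internal leg. -/
theorem inner_coslice_gluingMap (h : SU2) (hΨ : Ψ ∈ intertwinerSpace P Q n) (x x' : Legs P) :
    inner ℂ (coslice x (gluingMap n h Ψ)) (coslice x' (gluingMap n h Ψ)) =
      inner ℂ (coslice x (assoc Ψ)) (coslice x' (assoc Ψ)) := by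
  rw [eq_sum_of_hasSum_leg (n := n) (hasSum_inner_coslice_assoc Ψ Ψ x x') fun e he => by
    rw [coslice_of_mem_intertwinerSpace hΨ x he, inner_zero_left]]
  -- Orthonormality of the rows of `D(h)`: the point where the holonomy disappears.
  have hD : ∀ m k : Fin (n + 1), ∑ l, wignerD n h m l * (starRingEnd ℂ) (wignerD n h k l) =
      if m = k then 1 else 0 := fun m k => by
    simpa [Matrix.mul_apply, Matrix.one_apply, Matrix.conjTranspose_apply] using
      congrFun (congrFun (wignerD_mul_conjTranspose n h) m) k
  have hS : ∀ m m' k k' : Fin (n + 1),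
      (n + 1 : ℂ) * inner ℂ (coslice ⟨n, m'⟩ (coslice (x, ⟨n, m⟩) Ψ))
        (coslice ⟨n, k'⟩ (coslice (x', ⟨n, k⟩) Ψ)) =
      if m' = k' then (inner ℂ (coslice (x, ⟨n, m⟩) Ψ) (coslice (x', ⟨n, k⟩) Ψ) : ℂ) else 0 :=
    fun m m' k k' => inner_coslice (coslice_mem_rightIntertwiners hΨ _)
      (coslice_mem_rightIntertwiners hΨ _) m' k'
  calc _ = ∑ k, ∑ m, (∑ l, wignerD n h k l * (starRingEnd ℂ) (wignerD n h m l)) *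
        inner ℂ (coslice (x, ⟨n, m⟩) Ψ) (coslice (x', ⟨n, k⟩) Ψ) := by
        rw [coslice_gluingMap, coslice_gluingMap, inner_smul_left, inner_smul_right, ← mul_assoc,
          Complex.conj_ofReal, sqrt_dim_mul_self]
        simp only [inner_smul_left, inner_smul_right, sum_inner, inner_sum, Finset.mul_sum,
          Finset.sum_mul]
        refine Finset.sum_congr rfl fun k _ => ?_
        rw [Finset.sum_comm]
        refine Finset.sum_congr rfl fun m _ => Finset.sum_congr rfl fun l _ => ?_
        rw [Finset.sum_eq_single l]
        · have := hS m l k l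
          rw [if_pos rfl] at this
          rw [← this]; ring
        · intro l' _ hl'
          have := hS m l' k l
          rw [if_neg hl'] at this
          linear_combination wignerD n h k l * (starRingEnd ℂ) (wignerD n h m l') * this
        · simp
    _ = _ := by
        simp [hD]

theorem norm_gluingMap (h : SU2) (hΨ : Ψ ∈ intertwinerSpace P Q n) :
    ‖gluingMap n h Ψ‖ ^ 2 = ‖Ψ‖ ^ 2 := by
  have h1 := hasSum_inner_coslice (gluingMap n h Ψ) (gluingMap n h Ψ)
  simp only [inner_coslice_gluingMap h hΨ] at h1
  have h2 := h1.unique (hasSum_inner_coslice (assoc Ψ) (assoc Ψ))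
  rw [inner_self_eq_ofReal, inner_self_eq_ofReal, norm_assoc] at h2
  exact Complex.ofReal_injective h2

end Gluing

/-! ### Superpositions of internal spins -/

section Superposition

variable {P Q : ℕ} {α : ℕ → ℂ} {Ψ : ℕ → L2 ((Legs P × Leg) × (Leg × Legs Q))}

theorem norm_sq_smul_of_norm_eq_one {E : Type*} [NormedAddCommGroup E] [NormedSpace ℂ E] {a : ℂ}
    {v : E} (hv : a ≠ 0 → ‖v‖ ^ 2 = 1) : ‖a • v‖ ^ 2 = ‖a‖ ^ 2 := by
  by_cases ha : a = 0
  · simp [ha]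
  · rw [norm_smul, mul_pow, hv ha, mul_one]

theorem summable_graphState (hα : HasSum (fun n => ‖α n‖ ^ 2) 1)
    (hΨ : ∀ n, Ψ n ∈ intertwinerSpace P Q n) (hΨ_norm : ∀ n, α n ≠ 0 → ‖Ψ n‖ = 1) :
    Summable fun n => α n • Ψ n := by
  refine summable_of_pairwise_orthogonal (fun i j hij => ?_) (hα.summable.congr fun n => ?_)
  · rw [inner_smul_left, inner_smul_right, inner_intertwiner_of_ne hij (hΨ i) (hΨ j)]; simp
  · rw [norm_sq_smul_of_norm_eq_one fun h0 => by rw [hΨ_norm n h0, one_pow]]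

theorem summable_boundaryState (hα : HasSum (fun n => ‖α n‖ ^ 2) 1)
    (hΨ : ∀ n, Ψ n ∈ intertwinerSpace P Q n) (hΨ_norm : ∀ n, α n ≠ 0 → ‖Ψ n‖ = 1) (h : SU2) :
    Summable fun n => α n • gluingMap n h (Ψ n) := by
  refine summable_of_pairwise_orthogonal (fun i j hij => ?_) (hα.summable.congr fun n => ?_)
  · have h0 : inner ℂ (gluingMap i h (Ψ i)) (gluingMap j h (Ψ j)) = (0 : ℂ) :=
      (hasSum_inner_coslice _ _).unique (hasSum_zero.congr_fun fun x =>
        inner_coslice_gluingMap_of_ne hij h h (hΨ i) (hΨ j) x x)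
    rw [inner_smul_left, inner_smul_right, h0]; simp
  · rw [norm_sq_smul_of_norm_eq_one fun h0 => by
      rw [norm_gluingMap h (hΨ n), hΨ_norm n h0, one_pow]]

theorem inner_smul_smul_self {E : Type*} [NormedAddCommGroup E] [InnerProductSpace ℂ E] (a : ℂ)
    (u v : E) : inner ℂ (a • u) (a • v) = ((‖a‖ ^ 2 : ℝ) : ℂ) * inner ℂ u v := by
  rw [inner_smul_left, inner_smul_right, ← mul_assoc, mul_comm _ a, Complex.mul_conj,
    Complex.normSq_eq_norm_sq]

theorem norm_graphState (hα : HasSum (fun n => ‖α n‖ ^ 2) 1)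
    (hΨ : ∀ n, Ψ n ∈ intertwinerSpace P Q n) (hΨ_norm : ∀ n, α n ≠ 0 → ‖Ψ n‖ = 1) :
    ‖graphState α Ψ‖ ^ 2 = 1 := by
  have hs := (summable_graphState hα hΨ hΨ_norm).hasSum
  have h1 := hasSum_inner_of_orthogonal hs hs fun i j hij => by
    rw [inner_smul_left, inner_smul_right, inner_intertwiner_of_ne hij (hΨ i) (hΨ j)]; simp
  simp only [inner_self_eq_ofReal] at h1
  refine (Complex.hasSum_ofReal.1 h1).unique (hα.congr_fun fun n => ?_)
  rw [norm_sq_smul_of_norm_eq_one fun h0 => by rw [hΨ_norm n h0, one_pow]]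

/-- The Gram entries agree spin by spin. Since `h` is absent on the right, holonomy independence is
a corollary. -/
theorem reducedDensity_boundaryState (hα : HasSum (fun n => ‖α n‖ ^ 2) 1)
    (hΨ : ∀ n, Ψ n ∈ intertwinerSpace P Q n) (hΨ_norm : ∀ n, α n ≠ 0 → ‖Ψ n‖ = 1) (h : SU2) :
    reducedDensity (boundaryState α Ψ h) = partialTrace (reducedDensity (graphState α Ψ)) := by
  rw [partialTrace_reducedDensity]
  refine clm_ext_apply fun x' x => ?_
  rw [reducedDensity_ket, reducedDensity_ket]
  have hB := (summable_boundaryState hα hΨ hΨ_norm h).hasSum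
  have hG := (summable_graphState hα hΨ hΨ_norm).hasSum
  have h1 := hasSum_inner_of_orthogonal (hB.mapL (coslice x')) (hB.mapL (coslice x))
    fun i j hij => by
      rw [map_smul, map_smul, inner_smul_left, inner_smul_right,
        inner_coslice_gluingMap_of_ne hij h h (hΨ i) (hΨ j)]
      simp
  have h2 := hasSum_inner_of_orthogonal ((hG.mapL assoc).mapL (coslice x'))
    ((hG.mapL assoc).mapL (coslice x)) fun i j hij => by
      rw [map_smul, map_smul, map_smul, map_smul, inner_smul_left, inner_smul_right,
        inner_coslice_assoc_of_ne hij (hΨ i) (hΨ j)]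
      simp
  refine h1.unique (h2.congr_fun fun n => ?_)
  simp only [map_smul, inner_smul_smul_self, inner_coslice_gluingMap h (hΨ n)]

theorem hasSum_reducedDensity_graphState (hα : HasSum (fun n => ‖α n‖ ^ 2) 1)
    (hΨ : ∀ n, Ψ n ∈ intertwinerSpace P Q n) (hΨ_norm : ∀ n, α n ≠ 0 → ‖Ψ n‖ = 1) :
    HasSum (fun n => ((‖α n‖ ^ 2 : ℝ) : ℂ) • reducedDensity (Ψ n))
      (reducedDensity (graphState α Ψ)) := by
  have hs : Summable fun n => ((‖α n‖ ^ 2 : ℝ) : ℂ) • reducedDensity (Ψ n) := by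
    refine Summable.of_norm_bounded hα.summable fun n => ?_
    -- `Ψ n` is normalised only where `α n ≠ 0`.
    by_cases h0 : α n = 0
    · simp [h0]
    · have := norm_reducedDensity_le (Ψ n)
      rw [hΨ_norm n h0, one_pow] at this
      rw [norm_smul, Complex.norm_real, Real.norm_of_nonneg (by positivity)]
      exact mul_le_of_le_one_right (by positivity) this
  convert hs.hasSum using 1
  refine clm_ext_apply fun x' x => ?_
  have hG := (summable_graphState hα hΨ hΨ_norm).hasSum
  have h1 := hasSum_inner_of_orthogonal (hG.mapL (coslice x')) (hG.mapL (coslice x))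
    fun i j hij => by
      rw [map_smul, map_smul, inner_smul_left, inner_smul_right,
        inner_coslice_intertwiner_of_ne hij (hΨ i) (hΨ j)]
      simp
  have h2 := hs.hasSum.mapL
    ((innerSL ℂ (ket x)).comp (ContinuousLinearMap.apply ℂ (L2 (Legs P × Leg)) (ket x')))
  simp only [comp_apply, apply_apply, innerSL_apply_apply, inner_ket] at h2
  rw [reducedDensity_ket]
  refine h1.unique (h2.congr_fun fun n => ?_)
  simp only [map_smul, inner_smul_smul_self, smul_apply, lp.coeFn_smul, Pi.smul_apply,
    reducedDensity_ket, smul_eq_mul]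

end Superposition

end SpinNetwork

namespace SpinNetwork

open ContinuousLinearMap

/-! ### The entropy function -/

section NegMulLog

variable {H : Type} [NormedAddCommGroup H] [InnerProductSpace ℂ H] [CompleteSpace H]

/-- The spectrum lies in `[0, 1]`; hence `ENNReal.ofReal` in the entropy truncates nothing. -/
theorem negMulLog_nonneg_of_mem_spectrum {ρ : H →L[ℂ] H} (hρ : ρ.IsPositive) (h1 : ‖ρ‖ ≤ 1) :
    ∀ t ∈ spectrum ℝ ρ, 0 ≤ Real.negMulLog t := by
  intro t ht
  have h2 : 0 ≤ t := spectrum_nonneg_of_nonneg ((nonneg_iff_isPositive ρ).2 hρ) ht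
  have h3 : ‖t‖ ≤ 1 := by
    rcases subsingleton_or_nontrivial (H →L[ℂ] H) with hs | hs
    · simp [spectrum.of_subsingleton] at ht
    exact (spectrum.norm_le_norm_of_mem ht).trans h1
  exact Real.negMulLog_nonneg h2 ((le_abs_self t).trans h3)

/-- Functional calculus of `η(ct) = η(c) t + c η(t)` for `η = Real.negMulLog`. -/
theorem negMulLogOp_smul {ρ : H →L[ℂ] H} (hρ : IsSelfAdjoint ρ) (c : ℝ) :
    negMulLogOp ((c : ℂ) • ρ) = (Real.negMulLog c : ℂ) • ρ + (c : ℂ) • negMulLogOp ρ := by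
  have hc : ∀ (r : ℝ) (T : H →L[ℂ] H), (r : ℂ) • T = r • T := fun r T => rfl
  rw [hc, hc, hc, negMulLogOp, negMulLogOp, ← cfc_comp_const_mul c Real.negMulLog ρ
    Real.continuous_negMulLog.continuousOn]
  have h : (fun t => Real.negMulLog (c * t)) =
      fun t => Real.negMulLog c * t + c * Real.negMulLog t := by
    ext t; rw [Real.negMulLog_mul]; ring
  rw [h, cfc_add .., cfc_const_mul_id .., cfc_const_mul ..]

theorem negMulLogOp_zero : negMulLogOp (0 : H →L[ℂ] H) = 0 := by
  rw [negMulLogOp, cfc_apply_zero, Real.negMulLog_zero, map_zero]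

theorem re_inner_negMulLogOp_nonneg {ρ : H →L[ℂ] H} (hρ : ρ.IsPositive) (h1 : ‖ρ‖ ≤ 1) (v : H) :
    0 ≤ (inner ℂ v (negMulLogOp ρ v)).re := by
  have : 0 ≤ negMulLogOp ρ := cfc_nonneg (negMulLog_nonneg_of_mem_spectrum hρ h1)
  exact ((nonneg_iff_isPositive _).1 this).re_inner_nonneg_right v

end NegMulLog

/-- The distinguished basis as a Hilbert basis. -/
def ketBasis (X : Type) : HilbertBasis X ℂ (L2 X) :=
  HilbertBasis.ofRepr (LinearIsometryEquiv.refl ℂ (L2 X))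

theorem ketBasis_apply {X : Type} (x : X) : ketBasis X x = ket x := by
  classical
  rw [← (ketBasis X).repr_symm_single x]
  unfold ket
  congr

theorem entropy_eq {X : Type} (ρ : L2 X →L[ℂ] L2 X) :
    entropy ρ = ∑' x, ENNReal.ofReal (inner ℂ (ket x) (negMulLogOp ρ (ket x))).re := rfl

/-- The entropy of an orthogonal sum of operators. -/
theorem entropy_of_hasSum {X B ι : Type} {ρ : L2 X →L[ℂ] L2 X} (hρ : ρ.IsPositive)
    (hρ1 : ‖ρ‖ ≤ 1) {W : ι → L2 B →L[ℂ] L2 X} {P σ : ι → L2 B →L[ℂ] L2 B}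
    (hWW : ∀ i, (adjoint (W i)).comp (W i) = P i)
    (hWW0 : ∀ i j, i ≠ j → (adjoint (W i)).comp (W j) = 0)
    (hWP : ∀ i, (W i).comp (P i) = W i)
    (hσ : ∀ i, IsSelfAdjoint (σ i)) (hPσ : ∀ i, (P i).comp (σ i) = σ i)
    (hsum : HasSum (fun i => (W i).comp ((σ i).comp (adjoint (W i)))) ρ) :
    entropy ρ = ∑' i, entropy (σ i) := by
  have h := tsum_cfc_of_hasSum (ketBasis X) (ketBasis B) hρ.isSelfAdjoint hWW hWW0 hWP hσ hPσ hsum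
    Real.continuous_negMulLog Real.negMulLog_zero (negMulLog_nonneg_of_mem_spectrum hρ hρ1)
  simp only [ketBasis_apply] at h
  simp only [entropy_eq]
  exact h

/-- Unit norm of `u` means trace one, which turns the term `η(c) ρ` into the constant `η(c)`. -/
theorem entropy_smul_reducedDensity {X Y : Type} {u : L2 (X × Y)} (hu : ‖u‖ = 1) {c : ℝ}
    (hc0 : 0 ≤ c) (hc1 : c ≤ 1) :
    entropy ((c : ℂ) • reducedDensity u) =
      ENNReal.ofReal (Real.negMulLog c) + ENNReal.ofReal c * entropy (reducedDensity u) := by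
  have hρ := isPositive_reducedDensity u
  have hρ1 : ‖reducedDensity u‖ ≤ 1 := (norm_reducedDensity_le u).trans (by rw [hu, one_pow])
  have htr := tsum_reducedDensity_diag u
  rw [hu, one_pow, ENNReal.ofReal_one] at htr
  have hpos : ∀ x, 0 ≤ (reducedDensity u (ket x) x).re := fun x => by
    rw [← inner_ket]; exact hρ.re_inner_nonneg_right _
  have hη := Real.negMulLog_nonneg hc0 hc1
  rw [entropy_eq, entropy_eq, ← mul_one (ENNReal.ofReal (Real.negMulLog c)), ← htr,
    ← ENNReal.tsum_mul_left, ← ENNReal.tsum_mul_left, ← ENNReal.tsum_add]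
  refine tsum_congr fun x => ?_
  rw [← ENNReal.ofReal_mul hη, ← ENNReal.ofReal_mul hc0, ← ENNReal.ofReal_add
    (mul_nonneg hη (hpos x)) (mul_nonneg hc0 (re_inner_negMulLogOp_nonneg hρ hρ1 _)),
    negMulLogOp_smul hρ.isSelfAdjoint, add_apply, smul_apply, smul_apply, inner_add_right,
    inner_smul_right, inner_smul_right, inner_ket, Complex.add_re, Complex.re_ofReal_mul,
    Complex.re_ofReal_mul]

theorem entropy_zero {X : Type} : entropy (0 : L2 X →L[ℂ] L2 X) = 0 := by
  rw [entropy_eq, ENNReal.tsum_eq_zero]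
  intro x
  rw [negMulLogOp_zero, zero_apply, inner_zero_right, Complex.zero_re, ENNReal.ofReal_zero]

/-! ### Embedding of the left vertex into the boundary -/

/-- The range of a reduced density lies in the closed span of the slices. -/
theorem comp_reducedDensity_congr {X Y : Type} {F : Type*} [NormedAddCommGroup F] [NormedSpace ℂ F]
    {A B : L2 X →L[ℂ] F} {u : L2 (X × Y)} (h : ∀ y, A (slice y u) = B (slice y u)) :
    A.comp (reducedDensity u) = B.comp (reducedDensity u) := by
  ext v
  have h1 := (hasSum_reducedDensity u).mapL (ContinuousLinearMap.apply ℂ (L2 X) v)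
  refine (h1.mapL A).unique ((h1.mapL B).congr_fun fun y => ?_)
  simp [ketBra, h]

section Embedding

variable {P Q : ℕ}

instance (P n : ℕ) : CompleteSpace (leftIntertwiners P n) :=
  (isClosed_leftIntertwiners P n).completeSpace_coe

/-- The orthogonal projection onto the intertwiners at the left vertex. -/
def leftProjection (P n : ℕ) : L2 (Legs P × Leg) →L[ℂ] L2 (Legs P × Leg) :=
  (leftIntertwiners P n).starProjection

theorem leftProjection_mem (P n : ℕ) (u : L2 (Legs P × Leg)) :
    leftProjection P n u ∈ leftIntertwiners P n :=
  Submodule.starProjection_apply_mem _ u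

theorem leftProjection_of_mem {P n : ℕ} {u : L2 (Legs P × Leg)} (hu : u ∈ leftIntertwiners P n) :
    leftProjection P n u = u :=
  Submodule.starProjection_eq_self_iff.2 hu

theorem inner_leftProjection (P n : ℕ) (u v : L2 (Legs P × Leg)) :
    inner ℂ (leftProjection P n u) v = inner ℂ u (leftProjection P n v) :=
  Submodule.inner_starProjection_left_eq_right _ u v

/-- The partial isometry from the intertwiners at the left vertex to the boundary, obtained by
contracting the internal leg with the basis vector `e`. -/
def legIsometry (P : ℕ) (e : Leg) : L2 (Legs P × Leg) →L[ℂ] L2 (Legs P) :=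
  ((Real.sqrt (2 * spin e.1 + 1) : ℝ) : ℂ) • (slice e).comp (leftProjection P e.1)

/-- Schur orthogonality at the left vertex, with `√(2j+1)` from each side cancelling the `1/(2j+1)`.
-/
theorem inner_legIsometry (e e' : Leg) (u v : L2 (Legs P × Leg)) :
    inner ℂ (legIsometry P e u) (legIsometry P e' v) =
      if e = e' then (inner ℂ u (leftProjection P e.1 v) : ℂ) else 0 := by
  simp only [legIsometry, smul_apply, comp_apply, inner_smul_left, inner_smul_right,
    Complex.conj_ofReal]
  by_cases hn : e.1 = e'.1
  · obtain ⟨n, m⟩ := e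
    obtain ⟨n', m'⟩ := e'
    obtain rfl : n = n' := hn
    rw [← mul_assoc, sqrt_dim_mul_self,
      inner_slice (leftProjection_mem P n u) (leftProjection_mem P n v), inner_leftProjection,
      leftProjection_of_mem (leftProjection_mem P n v)]
    simp
  · rw [inner_slice_of_ne hn (leftProjection_mem P _ u) (leftProjection_mem P _ v),
      if_neg fun he => hn (congrArg Sigma.fst he)]
    simp

theorem adjoint_legIsometry_comp_self (e : Leg) :
    (adjoint (legIsometry P e)).comp (legIsometry P e) = leftProjection P e.1 := by
  ext1 v
  refine ext_inner_left ℂ fun u => ?_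
  rw [comp_apply, adjoint_inner_right, inner_legIsometry, if_pos rfl]

theorem adjoint_legIsometry_comp_of_ne {e e' : Leg} (he : e ≠ e') :
    (adjoint (legIsometry P e)).comp (legIsometry P e') = 0 := by
  ext1 v
  refine ext_inner_left ℂ fun u => ?_
  rw [comp_apply, adjoint_inner_right, inner_legIsometry, if_neg he, zero_apply, inner_zero_right]

theorem legIsometry_comp_leftProjection (e : Leg) :
    (legIsometry P e).comp (leftProjection P e.1) = legIsometry P e := by
  ext1 v
  simp only [legIsometry, smul_apply, comp_apply, leftProjection_of_mem (leftProjection_mem P _ v)]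

variable {n : ℕ} {Ψ : L2 ((Legs P × Leg) × (Leg × Legs Q))}

theorem leftProjection_comp_reducedDensity (hΨ : Ψ ∈ intertwinerSpace P Q n) :
    (leftProjection P n).comp (reducedDensity Ψ) = reducedDensity Ψ :=
  (comp_reducedDensity_congr (B := .id ℂ _) fun y =>
    leftProjection_of_mem (slice_mem_leftIntertwiners hΨ y)).trans (id_comp _)

theorem slice_comp_reducedDensity_of_ne (hΨ : Ψ ∈ intertwinerSpace P Q n) {e : Leg}
    (he : e.1 ≠ n) : (slice e).comp (reducedDensity Ψ) = 0 :=
  (comp_reducedDensity_congr (B := 0) fun y =>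
    slice_of_mem_left (slice_mem_leftIntertwiners hΨ y) he).trans (zero_comp _)

theorem legIsometry_comp_reducedDensity (e : Leg) (hΨ : Ψ ∈ intertwinerSpace P Q e.1) :
    (legIsometry P e).comp ((reducedDensity Ψ).comp (adjoint (legIsometry P e))) =
      (2 * spin e.1 + 1 : ℂ) • (slice e).comp ((reducedDensity Ψ).comp (adjoint (slice e))) := by
  have h1 : (legIsometry P e).comp (reducedDensity Ψ) =
      ((Real.sqrt (2 * spin e.1 + 1) : ℝ) : ℂ) • (slice e).comp (reducedDensity Ψ) := by
    rw [legIsometry, smul_comp, comp_assoc, leftProjection_comp_reducedDensity hΨ]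
  have h2 : (reducedDensity Ψ).comp (adjoint (legIsometry P e)) =
      ((Real.sqrt (2 * spin e.1 + 1) : ℝ) : ℂ) • (reducedDensity Ψ).comp (adjoint (slice e)) := by
    have := congrArg adjoint h1
    rw [adjoint_comp, (isPositive_reducedDensity Ψ).isSelfAdjoint.adjoint_eq] at this
    rw [this, map_smulₛₗ, adjoint_comp, (isPositive_reducedDensity Ψ).isSelfAdjoint.adjoint_eq,
      Complex.conj_ofReal]
  rw [h2, comp_smul, ← comp_assoc, h1, smul_comp, smul_smul, sqrt_dim_mul_self, comp_assoc, spin]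
  congr 1
  push_cast; ring

end Embedding

/-! ### The entropy of the boundary state -/

section Superposition

variable {P Q : ℕ} {α : ℕ → ℂ} {Ψ : ℕ → L2 ((Legs P × Leg) × (Leg × Legs Q))}

/-- The orthogonal blocks are indexed by `e = (j, m)`. Only spin `j` survives in the slice at `e`,
and rewriting slices as partial isometries costs the factor `1/(2j+1)`. -/
theorem entropy_partialTrace_graphState (hα : HasSum (fun n => ‖α n‖ ^ 2) 1)
    (hΨ : ∀ n, Ψ n ∈ intertwinerSpace P Q n) (hΨ_norm : ∀ n, α n ≠ 0 → ‖Ψ n‖ = 1) :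
    entropy (partialTrace (reducedDensity (graphState α Ψ))) =
      ∑' e : Leg, entropy (((‖α e.1‖ ^ 2 / (e.1 + 1) : ℝ) : ℂ) • reducedDensity (Ψ e.1)) := by
  rw [partialTrace_reducedDensity]
  refine entropy_of_hasSum (W := legIsometry P) (P := fun e => leftProjection P e.1)
    (isPositive_reducedDensity _) ((norm_reducedDensity_le _).trans ?_)
    adjoint_legIsometry_comp_self (fun e e' he => adjoint_legIsometry_comp_of_ne he)
    legIsometry_comp_leftProjection (fun e => ?_) (fun e => ?_) ?_
  · rw [norm_assoc, norm_graphState hα hΨ hΨ_norm]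
  · exact IsSelfAdjoint.smul (Complex.conj_ofReal _)
      (isPositive_reducedDensity (Ψ e.1)).isSelfAdjoint
  · rw [comp_smul, leftProjection_comp_reducedDensity (hΨ e.1)]
  · refine (hasSum_partialTrace_reducedDensity (graphState α Ψ)).congr_fun fun e => ?_
    have h1 := (hasSum_reducedDensity_graphState hα hΨ hΨ_norm).mapL
      ((compL ℂ (L2 (Legs P)) (L2 (Legs P × Leg)) (L2 (Legs P)) (slice e)).comp
      ((compL ℂ (L2 (Legs P)) (L2 (Legs P × Leg)) (L2 (Legs P × Leg))).flip (adjoint (slice e))))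
    simp only [comp_apply, flip_apply, compL_apply, smul_comp, comp_smul] at h1
    have h2 := h1.unique (hasSum_single e.1 fun n hn => by
      rw [← comp_assoc, slice_comp_reducedDensity_of_ne (hΨ n) hn.symm, zero_comp, smul_zero])
    rw [h2, smul_comp, comp_smul, legIsometry_comp_reducedDensity e (hΨ e.1), smul_smul]
    congr 1
    have : ((e.1 : ℂ) + 1) ≠ 0 := by exact_mod_cast e.1.succ_ne_zero
    rw [spin]
    push_cast
    field_simp

theorem tsum_leg (f : ℕ → ℝ≥0∞) :
    ∑' e : Leg, f e.1 = ∑' n : ℕ, ((n + 1 : ℕ) : ℝ≥0∞) * f n := by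
  rw [ENNReal.tsum_sigma']
  refine tsum_congr fun n => ?_
  rw [tsum_fintype]
  simp

theorem dim_mul_entropy_smul {n : ℕ} {a : ℂ} (ha : ‖a‖ ^ 2 ≤ 1)
    {Φ : L2 ((Legs P × Leg) × (Leg × Legs Q))} (hΦ : a ≠ 0 → ‖Φ‖ = 1) :
    ((n + 1 : ℕ) : ℝ≥0∞) * entropy (((‖a‖ ^ 2 / (n + 1) : ℝ) : ℂ) • reducedDensity Φ) =
      ENNReal.ofReal (‖a‖ ^ 2 * Real.log (2 * spin n + 1)) +
      ENNReal.ofReal (-(‖a‖ ^ 2 * Real.log (‖a‖ ^ 2))) +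
      ENNReal.ofReal (‖a‖ ^ 2) * entropy (reducedDensity Φ) := by
  -- Here `Φ` need not be normalised and its entropy is uncontrolled; the convention `0 * ∞ = 0`
  -- applies.
  by_cases h0 : a = 0
  · simp [h0, entropy_zero]
  have hp : 0 < ‖a‖ ^ 2 := by positivity
  set p := ‖a‖ ^ 2
  have hn : (0 : ℝ) < n + 1 := by positivity
  have hn1 : (1 : ℝ) ≤ n + 1 := by simp
  have hcast : ((n + 1 : ℕ) : ℝ≥0∞) = ENNReal.ofReal (n + 1 : ℝ) := by
    rw [← Nat.cast_succ, ENNReal.ofReal_natCast]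
  have hspin : 2 * spin n + 1 = (n : ℝ) + 1 := by rw [spin]; ring
  rw [entropy_smul_reducedDensity (hΦ h0) (by positivity) ((div_le_one hn).2 (ha.trans hn1)),
    hcast, mul_add, ← ENNReal.ofReal_mul hn.le, ← mul_assoc, ← ENNReal.ofReal_mul hn.le, mul_div_cancel₀ _ hn.ne',
    hspin, ← ENNReal.ofReal_add (mul_nonneg hp.le (Real.log_nonneg hn1))
      (neg_nonneg.2 (mul_nonpos_of_nonneg_of_nonpos hp.le (Real.log_nonpos hp.le ha)))]
  congr 2
  rw [Real.negMulLog, Real.log_div hp.ne' hn.ne']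
  field_simp
  ring

theorem entropy_boundary (hα : HasSum (fun n => ‖α n‖ ^ 2) 1)
    (hΨ : ∀ n, Ψ n ∈ intertwinerSpace P Q n) (hΨ_norm : ∀ n, α n ≠ 0 → ‖Ψ n‖ = 1) :
    entropy (partialTrace (reducedDensity (graphState α Ψ))) =
      ∑' n, (ENNReal.ofReal (‖α n‖ ^ 2 * Real.log (2 * spin n + 1)) +
        ENNReal.ofReal (-(‖α n‖ ^ 2 * Real.log (‖α n‖ ^ 2))) +
        ENNReal.ofReal (‖α n‖ ^ 2) * entropy (reducedDensity (Ψ n))) := by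
  rw [entropy_partialTrace_graphState hα hΨ hΨ_norm, tsum_leg fun n =>
    entropy (((‖α n‖ ^ 2 / (n + 1) : ℝ) : ℂ) • reducedDensity (Ψ n))]
  refine tsum_congr fun n => ?_
  have hn : ‖α n‖ ^ 2 ≤ 1 := le_hasSum hα n fun _ _ => by positivity
  exact dim_mul_entropy_smul hn (hΨ_norm n)

end Superposition

end SpinNetwork

end

theorem mainTheorem1 (P Q : ℕ) (α : ℕ → ℂ)
    (Ψ : ℕ → L2 ((Legs P × Leg) × (Leg × Legs Q)))
    (hα : HasSum (fun n => ‖α n‖ ^ 2) 1)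
    (hΨ : ∀ n, Ψ n ∈ intertwinerSpace P Q n)
    (hΨ_norm : ∀ n, α n ≠ 0 → ‖Ψ n‖ = 1)
    (h : SU2) :
    -- the series defining the intertwiner state and the boundary state converge
    Summable (fun n => α n • Ψ n) ∧
    Summable (fun n => α n • gluingMap n h (Ψ n)) ∧
    -- the boundary reduced density matrix does not depend on the holonomy
    reducedDensity (boundaryState α Ψ h) = reducedDensity (boundaryState α Ψ 1) ∧
    -- the intertwiner reduced density matrix is the direct sum over internal spins
    HasSum (fun n => ((‖α n‖ ^ 2 : ℝ) : ℂ) • reducedDensity (Ψ n))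
      (reducedDensity (graphState α Ψ)) ∧
    -- the boundary reduced density matrix is its partial trace over the internal leg
    reducedDensity (boundaryState α Ψ h) = partialTrace (reducedDensity (graphState α Ψ)) ∧
    -- the entropy formula
    entropy (reducedDensity (boundaryState α Ψ h)) =
      (∑' n, ENNReal.ofReal (‖α n‖ ^ 2 * Real.log (2 * spin n + 1))) +
      (∑' n, ENNReal.ofReal (-(‖α n‖ ^ 2 * Real.log (‖α n‖ ^ 2)))) +
      ∑' n, ENNReal.ofReal (‖α n‖ ^ 2) * entropy (reducedDensity (Ψ n)) := by
  have hpt := reducedDensity_boundaryState hα hΨ hΨ_norm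
  refine ⟨summable_graphState hα hΨ hΨ_norm, summable_boundaryState hα hΨ hΨ_norm h,
    (hpt h).trans (hpt 1).symm, hasSum_reducedDensity_graphState hα hΨ hΨ_norm, hpt h, ?_⟩
  -- In `[0, ∞]` the sum splits into three without any summability condition.
  rw [hpt h, entropy_boundary hα hΨ hΨ_norm, ENNReal.tsum_add, ENNReal.tsum_add]
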